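/- **Setup.** A *chain of $g$ loops* $\Gamma$ is the metric graph with vertices $w_0,\dots,w_g$ and $v_1,\dots,v_{g+1}$, with a bridge of length $n_k$ joining $w_k$ to $v_{k+1}$ for $0\le k\le g$, and with two edges, of lengths $\ell_k$ (top) and $m_k$ (bottom), joining $v_k$ to $w_k$ for $1\le k\le g$. For a continuous piecewise linear function $\psi$ with integral slopes, $\operatorname{div}\psi$ is the divisor whose coefficient at a point is the sum of the incoming slopes of $\psi$ there; divisors $D,D'$ are equivalent, $D\sim D'$, if $D'=D+\operatorname{div}\psi$ for some such $\psi$, and rank means Baker–Norine rank. Let $D$ be a divisor of rank $r$ on $\Gamma$. Its class is *vertex avoiding* if for every $0\le i\le r$ there is exactly one effective divisor $D_i\sim D$ with $D_i\ge i\,w_0+(r-i)\,v_{g+1}$, and $D_i-i\,w_0-(r-i)\,v_{g+1}$ has no vertex in its support. For a multiset $I\subset\{0,\dots,r\}$ of size $m$ let $\psi_I$ be a piecewise linear function with $mD+\operatorname{div}\psi_I=\sum_{i\in I}D_i$; it is unique up to an additive constant. A finite family $(f_i)_{i\in A}$ of functions on $\Gamma$ is *tropically dependent* if there are real constants $c_i$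 such that at every point of $\Gamma$ the minimum $\min_{i\in A}(f_i+c_i)$ is attained for at least two indices $i$, and *tropically independent* otherwise. Let $r\ge 3$, $s\ge 1$, $\rho\ge 0$, $m\ge 1$ be integers and put $g=(r+1)s+\rho$ and $d=g+r-s$. Fix an integer $b\ge 1$ (a block length; for $b=1$ condition (iv) below repeats (ii) and may be dropped). For a real number $C>0$, the edge lengths of a chain of $g$ loops are *$C$-admissible* (with respect to $r$ and $b$) if - (i) $4g\,m_k<\ell_k$ for $1\le k\le g$; - (ii) $C\,\ell_k\le\min\{n_{k-1},n_k\}$ for $1\le k\le g$; - (iii) there is no nontrivial relation $c_1m_1+\dots+c_gm_g=0$ with integers $|c_k|\le g+1$; - (iv) for every integer $0\le\alpha\le r$ with $(\alpha+1)b\le g$, $$C\Bigl(\sum_{i=\alpha b+1}^{(\alpha+1)b}\ell_i+\sum_{i=\alpha b+1}^{(\alpha+1)b-1}n_i\Bigr)\le\min\{n_{\alpha b},\,n_{(\alpha+1)b}\}.$$ The *tropical maximal rank conjecture for $(r,s,\rho,m)$* (with block length $b$) is the following assertion: there is a constant $C>0$, depending only on $b,r,s,\rho,m$, such that every chain of $g$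 loops with $C$-admissible edge lengths carries a divisor $D$ of rank $r$ and degree $d$ whose class is vertex avoiding, together with a set $\mathcal A$ of multisets of size $m$ in $\{0,\dots,r\}$ such that $$|\mathcal A|=\min\Bigl\{\tbinom{r+m}{m},\,md-g+1\Bigr\}$$ and the family $(\psi_I)_{I\in\mathcal A}$ is tropically independent. **Theorem 1.1.** Let $r\ge3$, $s\ge1$, $\rho\ge0$, $m\ge1$, $b\ge1$ be integers, and suppose that $(r,s,\rho,m)$ is in the *injective range*, i.e. $\binom{r+m}{m}\le md-g+1$. If the tropical maximal rank conjecture (with block length $b$) holds for $(r,s,\rho,m)$, then it holds (with the same block length $b$) for $(r,s,\rho+1,m)$ and for $(r,s+1,\rho,m)$. -/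

import Mathlib

open Filter Topology

/-! ### Metric graphs, piecewise linear functions, divisors -/

/-- A metric graph presented by a multigraph: every edge `e` is a closed interval of
length `len e > 0` glued at its two ends to the vertices `src e` and `tgt e`. -/
structure MetricGraph (V E : Type) where
  src : E → V
  tgt : E → V
  len : E → ℝ
  len_pos : ∀ e, 0 < len e

/-- Immediately to the right of `t`, the function `φ` is affine, and its slope when moving away
from `t` is the integer `k`. -/
def HasRightSlope (φ : ℝ → ℝ) (t : ℝ) (k : ℤ) : Prop :=
  ∀ᶠ u in 𝓝[>] t, φ u = φ t + k * (u - t)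

/-- Immediately to the left of `t`, the function `φ` is affine, and its slope when moving away
from `t` (that is, to the left) is the integer `k`. -/
def HasLeftSlope (φ : ℝ → ℝ) (t : ℝ) (k : ℤ) : Prop :=
  ∀ᶠ u in 𝓝[<] t, φ u = φ t + k * (t - u)

theorem HasRightSlope.unique {φ : ℝ → ℝ} {t : ℝ} {k l : ℤ}
    (hk : HasRightSlope φ t k) (hl : HasRightSlope φ t l) : k = l := by
  obtain ⟨u, ⟨h1, h2⟩, h3⟩ := ((hk.and hl).and self_mem_nhdsWithin).exists
  have h3 : t < u := h3
  have h4 : (k : ℝ) * (u - t) = l * (u - t) := by linarith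
  exact_mod_cast mul_right_cancel₀ (sub_ne_zero.2 h3.ne') h4

theorem HasLeftSlope.unique {φ : ℝ → ℝ} {t : ℝ} {k l : ℤ}
    (hk : HasLeftSlope φ t k) (hl : HasLeftSlope φ t l) : k = l := by
  obtain ⟨u, ⟨h1, h2⟩, h3⟩ := ((hk.and hl).and self_mem_nhdsWithin).exists
  have h3 : u < t := h3
  have h4 : (k : ℝ) * (t - u) = l * (t - u) := by linarith
  exact_mod_cast mul_right_cancel₀ (sub_ne_zero.2 h3.ne') h4

/-- The outgoing slope of `φ` at `t` to the right (used only where it exists). -/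
noncomputable def rightSlope (φ : ℝ → ℝ) (t : ℝ) : ℤ :=
  Classical.epsilon fun k => HasRightSlope φ t k

/-- The outgoing slope of `φ` at `t` to the left (used only where it exists). -/
noncomputable def leftSlope (φ : ℝ → ℝ) (t : ℝ) : ℤ :=
  Classical.epsilon fun k => HasLeftSlope φ t k

theorem HasRightSlope.rightSlope_eq {φ : ℝ → ℝ} {t : ℝ} {k : ℤ}
    (hk : HasRightSlope φ t k) : rightSlope φ t = k :=
  (Classical.epsilon_spec (p := fun k => HasRightSlope φ t k) ⟨k, hk⟩).unique hk

theorem HasLeftSlope.leftSlope_eq {φ : ℝ → ℝ} {t : ℝ} {k : ℤ}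
    (hk : HasLeftSlope φ t k) : leftSlope φ t = k :=
  (Classical.epsilon_spec (p := fun k => HasLeftSlope φ t k) ⟨k, hk⟩).unique hk

namespace MetricGraph

/-- The points of the metric graph: the vertices and the interior points of the edges. -/
abbrev Point {V E : Type} (G : MetricGraph V E) : Type :=
  V ⊕ (Σ e : E, Set.Ioo (0 : ℝ) (G.len e))

/-- A vertex as a point. -/
abbrev vert {V E : Type} (G : MetricGraph V E) (x : V) : G.Point := Sum.inl x

open Classical in
/-- The point of the edge `e` at distance `t ∈ [0, len e]` from `src e`
(for `t` outside of this interval, the nearer end of the edge). -/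
noncomputable def pt {V E : Type} (G : MetricGraph V E) (e : E) (t : ℝ) : G.Point :=
  if h : t ∈ Set.Ioo (0 : ℝ) (G.len e) then Sum.inr ⟨e, ⟨t, h⟩⟩
  else if t ≤ 0 then G.vert (G.src e) else G.vert (G.tgt e)

/-- Continuous piecewise linear functions with integral slopes: near every point, in every
direction, the function is affine with integral slope. Since the graph is compact, finitely many
linear pieces suffice. -/
def IsPL {V E : Type} (G : MetricGraph V E) (f : G.Point → ℝ) : Prop :=
  ∀ (e : E) (t : ℝ),
    (0 ≤ t → t < G.len e → ∃ k : ℤ, HasRightSlope (fun u => f (G.pt e u)) t k) ∧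
    (0 < t → t ≤ G.len e → ∃ k : ℤ, HasLeftSlope (fun u => f (G.pt e u)) t k)

open Classical in
/-- The coefficient of `div f` at a point: the sum of the incoming slopes of `f`, that is, minus
the sum of the outgoing slopes over all directions at this point. -/
noncomputable def ord {V E : Type} [Fintype E] (G : MetricGraph V E) (f : G.Point → ℝ) :
    G.Point → ℤ
  | Sum.inl x =>
      - ((∑ e, if G.src e = x then rightSlope (fun u => f (G.pt e u)) 0 else 0) +
         (∑ e, if G.tgt e = x then leftSlope (fun u => f (G.pt e u)) (G.len e) else 0))
  | Sum.inr ⟨e, t⟩ =>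
      - (rightSlope (fun u => f (G.pt e u)) t + leftSlope (fun u => f (G.pt e u)) t)

/-- Divisors: finite formal integral combinations of points. -/
abbrev Divisor {V E : Type} (G : MetricGraph V E) : Type := G.Point →₀ ℤ

/-- The degree of a divisor. -/
noncomputable def degree {V E : Type} {G : MetricGraph V E} (D : G.Divisor) : ℤ :=
  D.sum fun _ a => a

/-- The piecewise linear function `f` satisfies `D + div f = D'`. -/
def Moves {V E : Type} [Fintype E] (G : MetricGraph V E) (f : G.Point → ℝ)
    (D D' : G.Divisor) : Prop :=
  G.IsPL f ∧ ∀ x, D' x = D x + G.ord f x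

/-- Linear equivalence of divisors. -/
def LinEquiv {V E : Type} [Fintype E] (G : MetricGraph V E) (D D' : G.Divisor) : Prop :=
  ∃ f : G.Point → ℝ, G.Moves f D D'

/-- The (Baker–Norine) rank of `D` is at least `k`: for every effective divisor `F` of degree `k`,
the divisor `D - F` is equivalent to an effective divisor. -/
def RankGE {V E : Type} [Fintype E] (G : MetricGraph V E) (D : G.Divisor) (k : ℕ) : Prop :=
  ∀ F : G.Divisor, 0 ≤ F → degree F = k → ∃ D' : G.Divisor, 0 ≤ D' ∧ G.LinEquiv (D - F) D'

/-- The rank of `D` is equal to `r`. -/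
def HasRank {V E : Type} [Fintype E] (G : MetricGraph V E) (D : G.Divisor) (r : ℕ) : Prop :=
  G.RankGE D r ∧ ¬ G.RankGE D (r + 1)

end MetricGraph

/-- The family of functions `(f i)` for `i ∈ A` is tropically dependent: for suitable real
constants `c i`, the minimum of the `f i + c i` is attained at least twice at every point. -/
def TropicallyDependent {X ι : Type} (f : ι → X → ℝ) (A : Finset ι) : Prop :=
  ∃ c : ι → ℝ, ∀ x : X, ∃ i ∈ A, ∃ j ∈ A, i ≠ j ∧
    f i x + c i = f j x + c j ∧ ∀ k ∈ A, f i x + c i ≤ f k x + c k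

/-- Tropical independence. -/
def TropicallyIndependent {X ι : Type} (f : ι → X → ℝ) (A : Finset ι) : Prop :=
  ¬ TropicallyDependent f A

/-! ### The chain of loops -/

/-- Edge lengths of chains of loops, indexed as is customary: the `k`-th bridge joins `w_k` to
`v_{k+1}` for `0 ≤ k ≤ g`, and the top and bottom edges of the `k`-th loop join `v_k` to `w_k` for
`1 ≤ k ≤ g`. The values at other indices play no role for the chain of `g` loops. -/
structure ChainLengths where
  bridge : ℕ → ℝ
  top : ℕ → ℝ
  bottom : ℕ → ℝ
  bridge_pos : ∀ k, 0 < bridge k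
  top_pos : ∀ k, 0 < top k
  bottom_pos : ∀ k, 0 < bottom k

namespace ChainLengths

/-- The vertices of the chain of `g` loops: `Sum.inl k` is `w_k` and `Sum.inr k` is `v_{k+1}`,
for `0 ≤ k ≤ g`. -/
abbrev Vertex (g : ℕ) : Type := Fin (g + 1) ⊕ Fin (g + 1)

/-- The edges of the chain of `g` loops: `Sum.inl k` is the `k`-th bridge for `0 ≤ k ≤ g`, and
`Sum.inr (Sum.inl k)`, `Sum.inr (Sum.inr k)` are the top and the bottom edge of the loop number
`k + 1`, for `0 ≤ k < g`. -/
abbrev Edge (g : ℕ) : Type := Fin (g + 1) ⊕ (Fin g ⊕ Fin g)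

/-- The chain of `g` loops with bridges. -/
def chain (L : ChainLengths) (g : ℕ) : MetricGraph (Vertex g) (Edge g) where
  src
    | Sum.inl k => Sum.inl k
    | Sum.inr (Sum.inl k) => Sum.inr k.castSucc
    | Sum.inr (Sum.inr k) => Sum.inr k.castSucc
  tgt
    | Sum.inl k => Sum.inr k
    | Sum.inr (Sum.inl k) => Sum.inl k.succ
    | Sum.inr (Sum.inr k) => Sum.inl k.succ
  len
    | Sum.inl k => L.bridge k
    | Sum.inr (Sum.inl k) => L.top (k + 1)
    | Sum.inr (Sum.inr k) => L.bottom (k + 1)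
  len_pos
    | Sum.inl k => L.bridge_pos k
    | Sum.inr (Sum.inl k) => L.top_pos (k + 1)
    | Sum.inr (Sum.inr k) => L.bottom_pos (k + 1)

/-- The left end `w_0` of the chain. -/
def leftEnd (L : ChainLengths) (g : ℕ) : (L.chain g).Point := (L.chain g).vert (Sum.inl 0)

/-- The right end `v_{g+1}` of the chain. -/
def rightEnd (L : ChainLengths) (g : ℕ) : (L.chain g).Point :=
  (L.chain g).vert (Sum.inr (Fin.last g))

/-- Admissible edge lengths for the chain of `g` loops, where `x ≪ y` is read as `C * x ≤ y`.
The last clause says that the blocks numbered `α = 0, …, r`, each consisting of `b` consecutive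
loops, are much shorter than the bridges separating them; for `b = 1` it repeats the second
clause. -/
def Admissible (L : ChainLengths) (g r b : ℕ) (C : ℝ) : Prop :=
  (∀ k ∈ Finset.Icc 1 g, 4 * g * L.bottom k < L.top k) ∧
  (∀ k ∈ Finset.Icc 1 g, C * L.top k ≤ min (L.bridge (k - 1)) (L.bridge k)) ∧
  (∀ c : ℕ → ℤ, (∀ k ∈ Finset.Icc 1 g, |c k| ≤ g + 1) →
    ∑ k ∈ Finset.Icc 1 g, (c k : ℝ) * L.bottom k = 0 → ∀ k ∈ Finset.Icc 1 g, c k = 0) ∧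
  (∀ α : ℕ, α ≤ r → (α + 1) * b ≤ g →
    C * (∑ i ∈ Finset.Icc (α * b + 1) ((α + 1) * b), L.top i +
         ∑ i ∈ Finset.Icc (α * b + 1) ((α + 1) * b - 1), L.bridge i) ≤
      min (L.bridge (α * b)) (L.bridge ((α + 1) * b)))

/-- `D'` is an effective divisor equivalent to `D` with at least `i` chips at `w_0` and at least
`r - i` chips at `v_{g+1}`. -/
def IsSection (L : ChainLengths) (g r : ℕ) (D : (L.chain g).Divisor) (i : Fin (r + 1))
    (D' : (L.chain g).Divisor) : Prop :=
  (L.chain g).LinEquiv D D' ∧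
    Finsupp.single (L.leftEnd g) (i : ℤ) + Finsupp.single (L.rightEnd g) ((r : ℤ) - i) ≤ D' ∧
    0 ≤ D'

/-- The class of `D` (a divisor of rank `r`) is vertex avoiding: for `0 ≤ i ≤ r` there is
exactly one effective divisor `D_i` equivalent to `D` that contains
`i w_0 + (r - i) v_{g+1}`, and the difference is supported away from all vertices. In particular
`D_i` has degree exactly `i` at `w_0` and `r - i` at `v_{g+1}`. -/
def VertexAvoiding (L : ChainLengths) (g r : ℕ) (D : (L.chain g).Divisor) : Prop :=
  ∀ i : Fin (r + 1), ∃ D' : (L.chain g).Divisor, L.IsSection g r D i D' ∧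
    (∀ D'', L.IsSection g r D i D'' → D'' = D') ∧
    ∀ x : Vertex g, D' ((L.chain g).vert x) =
      (Finsupp.single (L.leftEnd g) (i : ℤ) + Finsupp.single (L.rightEnd g) ((r : ℤ) - i) :
        (L.chain g).Divisor) ((L.chain g).vert x)

end ChainLengths

/-! ### The tropical maximal rank conjecture -/

/-- The genus `g = (r + 1) s + ρ`. -/
def genus (r s ρ : ℕ) : ℕ := (r + 1) * s + ρ

/-- The degree `d = g + r - s`. -/
def curveDegree (r s ρ : ℕ) : ℤ := (genus r s ρ : ℤ) + r - s

/-- The expected dimension `m d - g + 1`. -/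
def expectedDim (r s ρ m : ℕ) : ℤ := m * curveDegree r s ρ - genus r s ρ + 1

/-- The injective range. -/
def InjectiveRange (r s ρ m : ℕ) : Prop :=
  ((r + m).choose m : ℤ) ≤ expectedDim r s ρ m

/-- The assertion of the tropical maximal rank conjecture, with parameters `r, s, ρ, m`, for one
chain of `g = (r + 1) s + ρ` loops. The multisets `I` of size `m` in `{0, …, r}` are the elements
of `Sym (Fin (r + 1)) m`. -/
def MaximalRankOn (L : ChainLengths) (r s ρ m : ℕ) : Prop :=
  ∃ D : (L.chain (genus r s ρ)).Divisor,
    (L.chain (genus r s ρ)).HasRank D r ∧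
    MetricGraph.degree D = curveDegree r s ρ ∧
    L.VertexAvoiding (genus r s ρ) r D ∧
    ∃ Di : Fin (r + 1) → (L.chain (genus r s ρ)).Divisor,
      (∀ i, L.IsSection (genus r s ρ) r D i (Di i)) ∧
    ∃ ψ : Sym (Fin (r + 1)) m → (L.chain (genus r s ρ)).Point → ℝ,
      (∀ I, (L.chain (genus r s ρ)).Moves (ψ I) (m • D) ((I : Multiset (Fin (r + 1))).map Di).sum) ∧
    ∃ A : Finset (Sym (Fin (r + 1)) m),
      (A.card : ℤ) = min ((r + m).choose m : ℤ) (expectedDim r s ρ m) ∧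
      TropicallyIndependent ψ A

/-- The tropical maximal rank conjecture for `(r, s, ρ, m)`: it holds on every chain of loops with
generic edge lengths, that is, whenever the edge lengths are admissible, with respect to blocks
of `b` loops and with sufficiently large ratios. -/
def TropicalMaximalRank (b r s ρ m : ℕ) : Prop :=
  ∃ C : ℝ, 0 < C ∧ ∀ L : ChainLengths, L.Admissible (genus r s ρ) r b C → MaximalRankOn L r s ρ m


/-!
In the injective range `𝒜` consists of all multisets of size `m`, and independence of the sums on a
subchain implies independence on the whole chain. It therefore suffices to continue the `r + 1`
functions of a vertex avoiding class, without changing them on the old chain, to further loops.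

On a new loop, put a chip `p` into the class with `p - v ∼ N (w - v)`. A section with multiplicity
`c ≠ N` at `v` then continues as `c v + p ∼ q + c w`, where `q - v ∼ (N - c) (w - v)`. If
`N - c = 1`, then `q = w` and the multiplicity rises to `N`; otherwise `q` lies in the interior of
the top edge, because `|N - c|` times the bottom length is less than the top length. Such remainders
are rigid by the maximum principle, and rigidity is preserved by wedges, which gives the uniqueness
of the sections of the longer chain.

With `N = -1` no multiplicity changes, which increases `ρ`. To increase `s`, lower all the
multiplicities `r - i` by one and then add `r + 1` loops with `N = r, r - 1, …, 0`, which raise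
them again one after another.
-/

/-! ### Slopes of functions of a real variable -/

section Slopes

variable {φ χ : ℝ → ℝ} {a b t : ℝ} {k l : ℤ}

theorem HasRightSlope.add (hφ : HasRightSlope φ t k) (hχ : HasRightSlope χ t l) :
    HasRightSlope (fun u => φ u + χ u) t (k + l) := by
  filter_upwards [hφ, hχ] with u hφu hχu
  rw [hφu, hχu]
  push_cast
  ring

theorem HasLeftSlope.add (hφ : HasLeftSlope φ t k) (hχ : HasLeftSlope χ t l) :
    HasLeftSlope (fun u => φ u + χ u) t (k + l) := by
  filter_upwards [hφ, hχ] with u hφu hχu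
  rw [hφu, hχu]
  push_cast
  ring

theorem HasRightSlope.int_mul (hφ : HasRightSlope φ t k) (n : ℤ) :
    HasRightSlope (fun u => n * φ u) t (n * k) := by
  filter_upwards [hφ] with u hφu
  rw [hφu]
  push_cast
  ring

theorem HasLeftSlope.int_mul (hφ : HasLeftSlope φ t k) (n : ℤ) :
    HasLeftSlope (fun u => n * φ u) t (n * k) := by
  filter_upwards [hφ] with u hφu
  rw [hφu]
  push_cast
  ring

theorem hasRightSlope_const (y t : ℝ) : HasRightSlope (fun _ => y) t 0 := by
  simp [HasRightSlope]

theorem hasLeftSlope_const (y t : ℝ) : HasLeftSlope (fun _ => y) t 0 := by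
  simp [HasLeftSlope]

theorem hasRightSlope_id (t : ℝ) : HasRightSlope (fun u => u) t 1 :=
  Eventually.of_forall fun _ => by push_cast; ring

theorem hasLeftSlope_id (t : ℝ) : HasLeftSlope (fun u => u) t (-1) :=
  Eventually.of_forall fun _ => by push_cast; ring

theorem HasRightSlope.congr (hφ : HasRightSlope φ t k) (htb : t < b)
    (h : ∀ u, t ≤ u → u < b → χ u = φ u) : HasRightSlope χ t k := by
  filter_upwards [hφ, Ioo_mem_nhdsGT htb] with u hφu hu
  rw [h u hu.1.le hu.2, h t le_rfl htb, hφu]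

theorem HasLeftSlope.congr (hφ : HasLeftSlope φ t k) (hat : a < t)
    (h : ∀ u, a < u → u ≤ t → χ u = φ u) : HasLeftSlope χ t k := by
  filter_upwards [hφ, Ioo_mem_nhdsLT hat] with u hφu hu
  rw [h u hu.1 hu.2.le, h t hat le_rfl, hφu]

theorem HasRightSlope.comp_const_sub (hφ : HasRightSlope φ (a - t) k) :
    HasLeftSlope (fun u => φ (a - u)) t k := by
  have hreflect : Tendsto (fun u => a - u) (𝓝[<] t) (𝓝[>] (a - t)) :=
    tendsto_nhdsWithin_iff.2
      ⟨((continuous_const.sub continuous_id).tendsto t).mono_left nhdsWithin_le_nhds,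
        by filter_upwards [self_mem_nhdsWithin] with u (hu : u < t) using sub_lt_sub_left hu a⟩
  filter_upwards [hreflect.eventually hφ] with u hu
  rw [hu]
  ring

theorem HasLeftSlope.comp_const_sub (hφ : HasLeftSlope φ (a - t) k) :
    HasRightSlope (fun u => φ (a - u)) t k := by
  have hreflect : Tendsto (fun u => a - u) (𝓝[>] t) (𝓝[<] (a - t)) :=
    tendsto_nhdsWithin_iff.2
      ⟨((continuous_const.sub continuous_id).tendsto t).mono_left nhdsWithin_le_nhds,
        by filter_upwards [self_mem_nhdsWithin] with u (hu : t < u) using sub_lt_sub_left hu a⟩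
  filter_upwards [hreflect.eventually hφ] with u hu
  rw [hu]
  ring

theorem HasRightSlope.continuousWithinAt (hφ : HasRightSlope φ t k) :
    ContinuousWithinAt φ (Set.Ioi t) t := by
  have hline : Continuous fun u : ℝ => φ t + k * (u - t) := by fun_prop
  have htendsto : Tendsto (fun u => φ t + k * (u - t)) (𝓝[>] t) (𝓝 (φ t)) := by
    simpa using (hline.tendsto t).mono_left nhdsWithin_le_nhds
  exact htendsto.congr' (hφ.mono fun _ hu => hu.symm)

theorem HasLeftSlope.continuousWithinAt (hφ : HasLeftSlope φ t k) :
    ContinuousWithinAt φ (Set.Iio t) t := by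
  have hline : Continuous fun u : ℝ => φ t + k * (t - u) := by fun_prop
  have htendsto : Tendsto (fun u => φ t + k * (t - u)) (𝓝[<] t) (𝓝 (φ t)) := by
    simpa using (hline.tendsto t).mono_left nhdsWithin_le_nhds
  exact htendsto.congr' (hφ.mono fun _ hu => hu.symm)

theorem HasRightSlope.le_of_line_le (hφ : HasRightSlope φ t k) (htb : t < b) {y : ℝ}
    (h : ∀ u ∈ Set.Ioo t b, φ t + y * (u - t) ≤ φ u) : y ≤ k := by
  obtain ⟨u, hφu, hu⟩ := (hφ.and (Ioo_mem_nhdsGT htb)).exists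
  have hline := h u hu
  rw [hφu] at hline
  exact le_of_mul_le_mul_right (by linarith) (sub_pos.2 hu.1)

theorem HasLeftSlope.le_of_line_le (hφ : HasLeftSlope φ t k) (hat : a < t) {y : ℝ}
    (h : ∀ u ∈ Set.Ioo a t, φ t + y * (t - u) ≤ φ u) : y ≤ k := by
  obtain ⟨u, hφu, hu⟩ := (hφ.and (Ioo_mem_nhdsLT hat)).exists
  have hline := h u hu
  rw [hφu] at hline
  exact le_of_mul_le_mul_right (by linarith) (sub_pos.2 hu.2)

theorem HasRightSlope.nonneg_of_forall_le (hφ : HasRightSlope φ t k) (h : ∀ u, φ t ≤ φ u) :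
    0 ≤ k := by
  have := hφ.le_of_line_le (y := 0) (lt_add_one t) fun u _ => by simpa using h u
  exact_mod_cast this

theorem HasLeftSlope.nonneg_of_forall_le (hφ : HasLeftSlope φ t k) (h : ∀ u, φ t ≤ φ u) :
    0 ≤ k := by
  have := hφ.le_of_line_le (y := 0) (sub_one_lt t) fun u _ => by simpa using h u
  exact_mod_cast this

end Slopes

/-- Continuous piecewise linear functions with integral slopes on the interval `[a, b]`. -/
def PLOn (φ : ℝ → ℝ) (a b : ℝ) : Prop :=
  ∀ t, (a ≤ t → t < b → ∃ k : ℤ, HasRightSlope φ t k) ∧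
    (a < t → t ≤ b → ∃ k : ℤ, HasLeftSlope φ t k)

namespace PLOn

variable {φ : ℝ → ℝ} {a b t : ℝ}

theorem right (h : PLOn φ a b) (hat : a ≤ t) (htb : t < b) :
    HasRightSlope φ t (rightSlope φ t) := by
  obtain ⟨k, hk⟩ := (h t).1 hat htb
  rwa [hk.rightSlope_eq]

theorem left (h : PLOn φ a b) (hat : a < t) (htb : t ≤ b) :
    HasLeftSlope φ t (leftSlope φ t) := by
  obtain ⟨k, hk⟩ := (h t).2 hat htb
  rwa [hk.leftSlope_eq]

theorem mono (h : PLOn φ a b) {a' b' : ℝ} (ha : a ≤ a') (hb : b' ≤ b) : PLOn φ a' b' :=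
  fun t => ⟨fun hat htb => (h t).1 (ha.trans hat) (htb.trans_le hb),
    fun hat htb => (h t).2 (ha.trans_lt hat) (htb.trans hb)⟩

theorem comp_const_sub (h : PLOn φ a b) : PLOn (fun u => φ (a + b - u)) a b := fun t =>
  ⟨fun hat htb => ⟨_, (h.left (t := a + b - t) (by linarith) (by linarith)).comp_const_sub⟩,
    fun hat htb => ⟨_, (h.right (t := a + b - t) (by linarith) (by linarith)).comp_const_sub⟩⟩

theorem leftSlope_comp_const_sub (h : PLOn φ a b) (hat : a < t) (htb : t ≤ b) :
    leftSlope (fun u => φ (a + b - u)) t = rightSlope φ (a + b - t) :=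
  (h.right (t := a + b - t) (by linarith) (by linarith)).comp_const_sub.leftSlope_eq

theorem rightSlope_comp_const_sub (h : PLOn φ a b) (hat : a ≤ t) (htb : t < b) :
    rightSlope (fun u => φ (a + b - u)) t = leftSlope φ (a + b - t) :=
  (h.left (t := a + b - t) (by linarith) (by linarith)).comp_const_sub.rightSlope_eq

theorem continuousOn (h : PLOn φ a b) : ContinuousOn φ (Set.Icc a b) := by
  intro t ht
  have hright : ContinuousWithinAt φ (Set.Icc a b ∩ Set.Ioi t) t := by
    rcases ht.2.eq_or_lt with rfl | htb
    · have hempty : Set.Icc a t ∩ Set.Ioi t = ∅ := by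
        ext u
        simp +contextual
      simp [hempty, ContinuousWithinAt]
    · exact (h.right ht.1 htb).continuousWithinAt.mono Set.inter_subset_right
  have hleft : ContinuousWithinAt φ (Set.Icc a b ∩ Set.Iio t) t := by
    rcases ht.1.eq_or_lt with rfl | hat
    · have hempty : Set.Icc a b ∩ Set.Iio a = ∅ := by
        ext u
        simp +contextual
      simp [hempty, ContinuousWithinAt]
    · exact (h.left hat ht.2).continuousWithinAt.mono Set.inter_subset_right
  refine ((hleft.union continuousWithinAt_singleton).union hright).mono fun u hu => ?_
  rcases lt_trichotomy u t with hut | hut | hut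
  · exact Or.inl (Or.inl ⟨hu, hut⟩)
  · exact Or.inl (Or.inr hut)
  · exact Or.inr ⟨hu, hut⟩

end PLOn

/-- Concave piecewise linear functions with integral slopes on `[a, b]`: at interior points the
outgoing slopes have nonpositive sum. -/
structure ConcavePLOn (φ : ℝ → ℝ) (a b : ℝ) : Prop where
  plOn : PLOn φ a b
  slopes_nonpos : ∀ t, a < t → t < b → rightSlope φ t + leftSlope φ t ≤ 0

namespace ConcavePLOn

variable {φ : ℝ → ℝ} {a b u : ℝ} {k : ℤ}

theorem mono (h : ConcavePLOn φ a b) {a' b' : ℝ} (ha : a ≤ a') (hb : b' ≤ b) :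
    ConcavePLOn φ a' b' :=
  ⟨h.plOn.mono ha hb, fun t hat htb => h.slopes_nonpos t (ha.trans_lt hat) (htb.trans_le hb)⟩

theorem comp_const_sub (h : ConcavePLOn φ a b) : ConcavePLOn (fun u => φ (a + b - u)) a b where
  plOn := h.plOn.comp_const_sub
  slopes_nonpos t hat htb := by
    rw [h.plOn.leftSlope_comp_const_sub hat htb.le, h.plOn.rightSlope_comp_const_sub hat.le htb,
      add_comm]
    exact h.slopes_nonpos _ (by linarith) (by linarith)

theorem le_right_tangent (h : ConcavePLOn φ a b) (hk : HasRightSlope φ a k) (hau : a ≤ u)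
    (hub : u ≤ b) : φ u ≤ φ a + k * (u - a) := by
  by_contra! hlt
  have hau' : a < u := hau.lt_of_ne (by rintro rfl; simp at hlt)
  have hsecant : (k : ℝ) < (φ u - φ a) / (u - a) := by
    rw [lt_div_iff₀ (sub_pos.2 hau')]
    linarith
  obtain ⟨y, hky, hy⟩ := exists_between (lt_min hsecant (lt_add_one (k : ℝ)))
  have hyu := (lt_div_iff₀ (sub_pos.2 hau')).1 (hy.trans_le (min_le_left _ _))
  -- Relative to a line of slope `y ∈ (k, k + 1)`, the function breaks upwards at its minimum.
  obtain ⟨t, ht, hmin⟩ := isCompact_Icc.exists_isMinOn (f := fun v => φ v - y * (v - a))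
    (Set.nonempty_Icc.2 hau)
    ((h.plOn.continuousOn.mono (Set.Icc_subset_Icc_right hub)).sub (by fun_prop))
  have hline : ∀ v ∈ Set.Icc a u, φ t + y * (v - t) ≤ φ v := fun v hv => by
    have hmin_v : φ t - y * (t - a) ≤ φ v - y * (v - a) := hmin hv
    linarith
  have htu : t < u := ht.2.lt_of_ne fun htu => by
    have hta := hline a ⟨le_rfl, hau⟩
    subst htu
    linarith
  have hright : ∀ {l : ℤ}, HasRightSlope φ t l → k + 1 ≤ l := fun hl => by
    have hyl := hl.le_of_line_le htu fun v hv => hline v ⟨ht.1.trans hv.1.le, hv.2.le⟩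
    exact_mod_cast hky.trans_le hyl
  have hat : a < t := ht.1.lt_of_ne fun hat => by
    have := hright (hat ▸ hk)
    omega
  have hleft := (h.plOn.left hat (ht.2.trans hub)).le_of_line_le (y := -y) hat fun v hv => by
    linarith [hline v ⟨hv.1.le, hv.2.le.trans ht.2⟩]
  have hleft : -k - 1 < leftSlope φ t := by
    have hyk := hy.trans_le (min_le_right _ _)
    exact_mod_cast (by push_cast; linarith : ((-k - 1 : ℤ) : ℝ) < leftSlope φ t)
  have := hright (h.plOn.right hat.le (htu.trans_le hub))
  have := h.slopes_nonpos t hat (htu.trans_le hub)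
  omega

theorem le_left_tangent (h : ConcavePLOn φ a b) (hk : HasLeftSlope φ b k) (hau : a ≤ u)
    (hub : u ≤ b) : φ u ≤ φ b + k * (b - u) := by
  have hreflect := h.comp_const_sub.le_right_tangent (k := k) (u := a + b - u)
    (HasLeftSlope.comp_const_sub (by simpa using hk)) (by linarith) (by linarith)
  simp only [sub_sub_cancel, add_sub_cancel_left] at hreflect
  linarith

theorem min_le (h : ConcavePLOn φ a b) (hau : a ≤ u) (hub : u ≤ b) :
    min (φ a) (φ b) ≤ φ u := by
  rcases hau.eq_or_lt with rfl | hau'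
  · exact min_le_left _ _
  rcases hub.eq_or_lt with rfl | hub'
  · exact min_le_right _ _
  have hb := (h.mono hau le_rfl).le_right_tangent (h.plOn.right hau hub') hub le_rfl
  have ha := (h.mono le_rfl hub).le_left_tangent (h.plOn.left hau' hub) le_rfl hau
  have hsum := h.slopes_nonpos u hau' hub'
  rcases le_or_gt (rightSlope φ u) 0 with hR | hR
  · have hR : (rightSlope φ u : ℝ) ≤ 0 := by exact_mod_cast hR
    exact (min_le_right _ _).trans (by nlinarith)
  · have hL : (leftSlope φ u : ℝ) ≤ 0 := by exact_mod_cast (by omega : leftSlope φ u ≤ 0)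
    exact (min_le_left _ _).trans (by nlinarith)

theorem rightSlope_pos (h : ConcavePLOn φ a b) (hab : a < b) (hφ : φ a < φ b)
    (hk : HasRightSlope φ a k) : 0 < k := by
  have htangent := h.le_right_tangent hk hab.le le_rfl
  have : (0 : ℝ) < k := pos_of_mul_pos_left (by linarith) (sub_pos.2 hab).le
  exact_mod_cast this

theorem leftSlope_pos (h : ConcavePLOn φ a b) (hab : a < b) (hφ : φ b < φ a)
    (hk : HasLeftSlope φ b k) : 0 < k := by
  have htangent := h.le_left_tangent hk le_rfl hab.le
  have : (0 : ℝ) < k := pos_of_mul_pos_left (by linarith) (sub_pos.2 hab).le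
  exact_mod_cast this

theorem eq_of_rightSlope_nonpos (h : ConcavePLOn φ a b) (hφ : φ a ≤ φ b)
    (hk : HasRightSlope φ a k) (hk0 : k ≤ 0) (hau : a ≤ u) (hub : u ≤ b) : φ u = φ a := by
  refine le_antisymm ?_ (by simpa only [min_eq_left hφ] using h.min_le hau hub)
  have hk0 : (k : ℝ) ≤ 0 := by exact_mod_cast hk0
  nlinarith [h.le_right_tangent hk hau hub]

theorem eq_of_leftSlope_nonpos (h : ConcavePLOn φ a b) (hφ : φ b ≤ φ a)
    (hk : HasLeftSlope φ b k) (hk0 : k ≤ 0) (hau : a ≤ u) (hub : u ≤ b) : φ u = φ b := by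
  refine le_antisymm ?_ (by simpa only [min_eq_right hφ] using h.min_le hau hub)
  have hk0 : (k : ℝ) ≤ 0 := by exact_mod_cast hk0
  nlinarith [h.le_left_tangent hk hau hub]

end ConcavePLOn

section RampSum

variable {X : Type} (D : X →₀ ℤ) (p : X → ℝ) (t : ℝ)

/-- The piecewise linear function with a break of size `D x` at the position `p x`, for every `x`
in the support of `D`, that vanishes to the left of all of them. -/
noncomputable def rampSum (u : ℝ) : ℝ := D.sum fun x n => n * max (u - p x) 0

theorem hasRightSlope_ramp (q : ℝ) :
    HasRightSlope (fun u => max (u - q) 0) t (if q ≤ t then 1 else 0) := by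
  split_ifs with hqt
  · refine ((hasRightSlope_id t).add (hasRightSlope_const (-q) t)).congr (lt_add_one t)
      fun u htu _ => ?_
    rw [max_eq_left (by linarith), sub_eq_add_neg]
  · refine (hasRightSlope_const 0 t).congr (not_le.1 hqt) fun u _ huq => ?_
    rw [max_eq_right (by linarith)]

theorem hasLeftSlope_ramp (q : ℝ) :
    HasLeftSlope (fun u => max (u - q) 0) t (if q < t then -1 else 0) := by
  split_ifs with hqt
  · refine ((hasLeftSlope_id t).add (hasLeftSlope_const (-q) t)).congr hqt fun u hqu _ => ?_
    rw [max_eq_left (by linarith), sub_eq_add_neg]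
  · refine (hasLeftSlope_const 0 t).congr (sub_one_lt t) fun u _ hut => ?_
    rw [max_eq_right (by linarith)]

theorem hasRightSlope_rampSum :
    HasRightSlope (rampSum D p) t (D.sum fun x n => if p x ≤ t then n else 0) := by
  unfold rampSum Finsupp.sum
  induction D.support using Finset.cons_induction with
  | empty => simpa using hasRightSlope_const 0 t
  | cons x S hx ih =>
    simp only [Finset.sum_cons]
    simpa using ((hasRightSlope_ramp t (p x)).int_mul (D x)).add ih

theorem hasLeftSlope_rampSum :
    HasLeftSlope (rampSum D p) t (-D.sum fun x n => if p x < t then n else 0) := by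
  unfold rampSum Finsupp.sum
  induction D.support using Finset.cons_induction with
  | empty => simpa using hasLeftSlope_const 0 t
  | cons x S hx ih =>
    simp only [Finset.sum_cons, neg_add]
    convert ((hasLeftSlope_ramp t (p x)).int_mul (D x)).add ih using 2
    split_ifs <;> simp

theorem sum_le_sub_sum_lt (hp : Function.Injective p) (x : X) :
    (D.sum fun y n => if p y ≤ p x then n else 0) - (D.sum fun y n => if p y < p x then n else 0) =
      D x := by
  classical
  rw [← Finsupp.sum_sub, ← Finsupp.sum_ite_self_eq' D x]
  refine Finset.sum_congr rfl fun y _ => ?_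
  rcases lt_trichotomy (p y) (p x) with hlt | heq | hgt
  · simp [hlt, hlt.le, ne_of_apply_ne _ hlt.ne]
  · simp [hp heq]
  · simp [hgt.not_ge, hgt.not_gt, ne_of_apply_ne _ hgt.ne']

end RampSum

namespace MetricGraph

variable {V E : Type} {G : MetricGraph V E}

theorem pt_of_mem (e : E) {t : ℝ} (h : t ∈ Set.Ioo 0 (G.len e)) :
    G.pt e t = Sum.inr ⟨e, ⟨t, h⟩⟩ := dif_pos h

@[simp] theorem pt_zero (e : E) : G.pt e 0 = G.vert (G.src e) := by
  simp [pt]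

@[simp] theorem pt_len (e : E) : G.pt e (G.len e) = G.vert (G.tgt e) := by
  simp [pt, (G.len_pos e).not_ge]

section Degree

theorem degree_add (A B : G.Divisor) : degree (A + B) = degree A + degree B :=
  Finsupp.sum_add_index' (fun _ => rfl) fun _ _ _ => rfl

theorem degree_single (x : G.Point) (n : ℤ) : degree (G := G) (Finsupp.single x n) = n :=
  Finsupp.sum_single_index rfl

theorem degree_sub (A B : G.Divisor) : degree (A - B) = degree A - degree B :=
  Finsupp.sum_sub_index fun _ _ _ => rfl

theorem degree_nonneg {A : G.Divisor} (hA : 0 ≤ A) : 0 ≤ degree A :=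
  Finset.sum_nonneg fun x _ => hA x

theorem eq_zero_of_degree_nonpos {A : G.Divisor} (hA : 0 ≤ A) (hdeg : degree A ≤ 0) : A = 0 := by
  have hsum : ∑ x ∈ A.support, A x = 0 := le_antisymm hdeg (degree_nonneg hA)
  have hzero := (Finset.sum_eq_zero_iff_of_nonneg fun x _ => hA x).1 hsum
  ext x
  by_cases hx : x ∈ A.support
  · exact hzero x hx
  · exact Finsupp.notMem_support_iff.1 hx

end Degree

/-! ### Piecewise linear functions on metric graphs -/

theorem IsPL.plOn {f : G.Point → ℝ} (hf : G.IsPL f) (e : E) :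
    PLOn (fun u => f (G.pt e u)) 0 (G.len e) := hf e

theorem isPL_const (y : ℝ) : G.IsPL fun _ => y :=
  fun _ _ => ⟨fun _ _ => ⟨0, hasRightSlope_const _ _⟩, fun _ _ => ⟨0, hasLeftSlope_const _ _⟩⟩

theorem IsPL.add {f f' : G.Point → ℝ} (hf : G.IsPL f) (hf' : G.IsPL f') :
    G.IsPL fun x => f x + f' x :=
  fun e _ => ⟨fun h₀ h₁ => ⟨_, ((hf.plOn e).right h₀ h₁).add ((hf'.plOn e).right h₀ h₁)⟩,
    fun h₀ h₁ => ⟨_, ((hf.plOn e).left h₀ h₁).add ((hf'.plOn e).left h₀ h₁)⟩⟩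

theorem IsPL.int_mul {f : G.Point → ℝ} (hf : G.IsPL f) (n : ℤ) : G.IsPL fun x => n * f x :=
  fun e _ => ⟨fun h₀ h₁ => ⟨_, ((hf.plOn e).right h₀ h₁).int_mul n⟩,
    fun h₀ h₁ => ⟨_, ((hf.plOn e).left h₀ h₁).int_mul n⟩⟩

variable [Fintype E]

theorem ord_const (y : ℝ) (x : G.Point) : G.ord (fun _ => y) x = 0 := by
  rcases x with x | ⟨e, t⟩ <;>
  simp [ord, (hasRightSlope_const y _).rightSlope_eq, (hasLeftSlope_const y _).leftSlope_eq]

theorem IsPL.ord_add {f f' : G.Point → ℝ} (hf : G.IsPL f) (hf' : G.IsPL f') (x : G.Point) :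
    G.ord (fun x => f x + f' x) x = G.ord f x + G.ord f' x := by
  have hright : ∀ e t, 0 ≤ t → t < G.len e →
      rightSlope (fun u => f (G.pt e u) + f' (G.pt e u)) t =
        rightSlope (fun u => f (G.pt e u)) t + rightSlope (fun u => f' (G.pt e u)) t :=
    fun e t h₀ h₁ => (((hf.plOn e).right h₀ h₁).add ((hf'.plOn e).right h₀ h₁)).rightSlope_eq
  have hleft : ∀ e t, 0 < t → t ≤ G.len e →
      leftSlope (fun u => f (G.pt e u) + f' (G.pt e u)) t =
        leftSlope (fun u => f (G.pt e u)) t + leftSlope (fun u => f' (G.pt e u)) t :=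
    fun e t h₀ h₁ => (((hf.plOn e).left h₀ h₁).add ((hf'.plOn e).left h₀ h₁)).leftSlope_eq
  rcases x with x | ⟨e, t⟩
  · simp only [ord, hright _ 0 le_rfl (G.len_pos _), hleft _ _ (G.len_pos _) le_rfl,
      ← Finset.sum_filter, Finset.sum_add_distrib]
    ring
  · simp only [ord, hright e t t.2.1.le t.2.2, hleft e t t.2.1 t.2.2.le]
    ring

theorem IsPL.ord_int_mul {f : G.Point → ℝ} (hf : G.IsPL f) (n : ℤ) (x : G.Point) :
    G.ord (fun x => n * f x) x = n * G.ord f x := by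
  have hright : ∀ e t, 0 ≤ t → t < G.len e → rightSlope (fun u => n * f (G.pt e u)) t =
      n * rightSlope (fun u => f (G.pt e u)) t :=
    fun e t h₀ h₁ => (((hf.plOn e).right h₀ h₁).int_mul n).rightSlope_eq
  have hleft : ∀ e t, 0 < t → t ≤ G.len e → leftSlope (fun u => n * f (G.pt e u)) t =
      n * leftSlope (fun u => f (G.pt e u)) t :=
    fun e t h₀ h₁ => (((hf.plOn e).left h₀ h₁).int_mul n).leftSlope_eq
  rcases x with x | ⟨e, t⟩
  · simp only [ord, hright _ 0 le_rfl (G.len_pos _), hleft _ _ (G.len_pos _) le_rfl,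
      ← Finset.sum_filter, ← Finset.mul_sum]
    ring
  · simp only [ord, hright e t t.2.1.le t.2.2, hleft e t t.2.1 t.2.2.le]
    ring

/-! ### Linear equivalence -/

section LinEquiv

variable {f f' : G.Point → ℝ} {A A' B B' C : G.Divisor}

theorem Moves.add (h : G.Moves f A A') (h' : G.Moves f' B B') :
    G.Moves (fun x => f x + f' x) (A + B) (A' + B') :=
  ⟨h.1.add h'.1, fun x => by
    rw [h.1.ord_add h'.1, Finsupp.add_apply, Finsupp.add_apply, h.2, h'.2]
    ring⟩

theorem Moves.trans (h : G.Moves f A B) (h' : G.Moves f' B C) :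
    G.Moves (fun x => f x + f' x) A C :=
  ⟨h.1.add h'.1, fun x => by rw [h.1.ord_add h'.1, h'.2, h.2, add_assoc]⟩

theorem Moves.int_mul (h : G.Moves f A B) (n : ℤ) :
    G.Moves (fun x => n * f x) (n • A) (n • B) :=
  ⟨h.1.int_mul n, fun x => by
    rw [h.1.ord_int_mul, Finsupp.smul_apply, Finsupp.smul_apply, h.2, smul_add, smul_eq_mul,
      smul_eq_mul]⟩

theorem moves_const (y : ℝ) (A : G.Divisor) : G.Moves (fun _ => y) A A :=
  ⟨isPL_const y, fun x => by rw [ord_const, add_zero]⟩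

theorem Moves.add_const (h : G.Moves f A B) (y : ℝ) : G.Moves (fun x => f x + y) A B :=
  h.trans (moves_const y B)

theorem moves_multiset_sum {ι : Type} {φ : ι → G.Point → ℝ} {D : G.Divisor} {F : ι → G.Divisor}
    (h : ∀ i, G.Moves (φ i) D (F i)) (I : Multiset ι) :
    G.Moves (fun x => (I.map fun i => φ i x).sum) (I.card • D) (I.map F).sum := by
  induction I using Multiset.induction_on with
  | empty => simpa using moves_const 0 0
  | cons i I ih =>
    simp only [Multiset.map_cons, Multiset.sum_cons, Multiset.card_cons, succ_nsmul']
    exact (h i).add ih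

theorem LinEquiv.refl (A : G.Divisor) : G.LinEquiv A A := ⟨_, moves_const 0 A⟩

theorem LinEquiv.trans (h : G.LinEquiv A B) (h' : G.LinEquiv B C) : G.LinEquiv A C :=
  let ⟨_, hf⟩ := h
  let ⟨_, hf'⟩ := h'
  ⟨_, hf.trans hf'⟩

theorem LinEquiv.add (h : G.LinEquiv A A') (h' : G.LinEquiv B B') :
    G.LinEquiv (A + B) (A' + B') :=
  let ⟨_, hf⟩ := h
  let ⟨_, hf'⟩ := h'
  ⟨_, hf.add hf'⟩

theorem LinEquiv.zsmul (h : G.LinEquiv A B) (n : ℤ) : G.LinEquiv (n • A) (n • B) :=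
  let ⟨_, hf⟩ := h
  ⟨_, hf.int_mul n⟩

theorem LinEquiv.add_right (h : G.LinEquiv A B) (C : G.Divisor) : G.LinEquiv (A + C) (B + C) :=
  h.add (.refl C)

theorem LinEquiv.sub_right (h : G.LinEquiv A B) (C : G.Divisor) : G.LinEquiv (A - C) (B - C) := by
  simpa only [sub_eq_add_neg] using h.add_right (-C)

theorem LinEquiv.symm (h : G.LinEquiv A B) : G.LinEquiv B A := by
  simpa using (h.zsmul (-1)).add_right (A + B)

theorem LinEquiv.of_sub (h : G.LinEquiv (A - B) 0) : G.LinEquiv A B := by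
  simpa using h.add_right B

end LinEquiv

/-! ### The maximum principle -/

/-- The vertices of the metric graph are connected by the edges in `T`: a nonempty set of vertices
that is closed under adjacency by such edges contains all vertices. -/
def ConnectedBy {V E : Type} (G : MetricGraph V E) (T : Set E) : Prop :=
  ∀ S : Set V, S.Nonempty → (∀ e ∈ T, G.src e ∈ S ↔ G.tgt e ∈ S) → S = Set.univ

omit [Fintype E] in
theorem ConnectedBy.mono {T T' : Set E} (hG : G.ConnectedBy T) (hT : T ⊆ T') :
    G.ConnectedBy T' := fun S hS h => hG S hS fun e he => h e (hT he)

section MaximumPrinciple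

variable {f : G.Point → ℝ}

theorem IsPL.concavePLOn (hf : G.IsPL f) {e : E} {a b : ℝ} (ha : 0 ≤ a) (hb : b ≤ G.len e)
    (hord : ∀ u (hu : u ∈ Set.Ioo 0 (G.len e)), a < u → u < b → 0 ≤ G.ord f (Sum.inr ⟨e, u, hu⟩)) :
    ConcavePLOn (fun u => f (G.pt e u)) a b where
  plOn := (hf.plOn e).mono ha hb
  slopes_nonpos u hau hub :=
    neg_nonneg.1 (hord u ⟨ha.trans_lt hau, hub.trans_le hb⟩ hau hub)

theorem IsPL.slopes_nonpos_of_minimal (hf : G.IsPL f) {y : V} (hord : 0 ≤ G.ord f (G.vert y))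
    (hmin : ∀ x, f (G.vert y) ≤ f x) :
    (∀ e, G.src e = y → rightSlope (fun u => f (G.pt e u)) 0 ≤ 0) ∧
      ∀ e, G.tgt e = y → leftSlope (fun u => f (G.pt e u)) (G.len e) ≤ 0 := by
  classical
  have hsrc : ∀ e, 0 ≤ if G.src e = y then rightSlope (fun u => f (G.pt e u)) 0 else 0 := by
    intro e
    split_ifs with he
    · exact ((hf.plOn e).right le_rfl (G.len_pos e)).nonneg_of_forall_le
        fun u => by simpa only [pt_zero, he] using hmin _
    · exact le_rfl
  have htgt : ∀ e, 0 ≤ if G.tgt e = y then leftSlope (fun u => f (G.pt e u)) (G.len e) else 0 := by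
    intro e
    split_ifs with he
    · exact ((hf.plOn e).left (G.len_pos e) le_rfl).nonneg_of_forall_le
        fun u => by simpa only [pt_len, he] using hmin _
    · exact le_rfl
  have hsum : _ + _ ≤ (0 : ℤ) := neg_nonneg.1 hord
  have hsum_src := Finset.sum_nonneg fun e (_ : e ∈ Finset.univ) => hsrc e
  have hsum_tgt := Finset.sum_nonneg fun e (_ : e ∈ Finset.univ) => htgt e
  refine ⟨fun e he => ?_, fun e he => ?_⟩
  · have hle := Finset.single_le_sum (fun e _ => hsrc e) (Finset.mem_univ e)
    rw [if_pos he] at hle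
    omega
  · have hle := Finset.single_le_sum (fun e _ => htgt e) (Finset.mem_univ e)
    rw [if_pos he] at hle
    omega

theorem IsPL.eq_right_of_minimal (hf : G.IsPL f) {e : E}
    (hord : 0 ≤ G.ord f (G.vert (G.src e))) (hmin : ∀ x, f (G.vert (G.src e)) ≤ f x) {b : ℝ}
    (hconcave : ConcavePLOn (fun u => f (G.pt e u)) 0 b) {u : ℝ} (hu : u ∈ Set.Icc 0 b) :
    f (G.pt e u) = f (G.vert (G.src e)) := by
  simpa only [pt_zero] using hconcave.eq_of_rightSlope_nonpos
    (by simpa only [pt_zero] using hmin _) ((hf.plOn e).right le_rfl (G.len_pos e))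
    ((hf.slopes_nonpos_of_minimal hord hmin).1 e rfl) hu.1 hu.2

theorem IsPL.eq_left_of_minimal (hf : G.IsPL f) {e : E}
    (hord : 0 ≤ G.ord f (G.vert (G.tgt e))) (hmin : ∀ x, f (G.vert (G.tgt e)) ≤ f x) {a : ℝ}
    (hconcave : ConcavePLOn (fun u => f (G.pt e u)) a (G.len e)) {u : ℝ}
    (hu : u ∈ Set.Icc a (G.len e)) : f (G.pt e u) = f (G.vert (G.tgt e)) := by
  simpa only [pt_len] using hconcave.eq_of_leftSlope_nonpos
    (by simpa only [pt_len] using hmin _) ((hf.plOn e).left (G.len_pos e) le_rfl)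
    ((hf.slopes_nonpos_of_minimal hord hmin).2 e rfl) hu.1 hu.2

theorem IsPL.eq_on_vertices_of_minimal {T : Set E} (hG : G.ConnectedBy T) (hf : G.IsPL f)
    (hord : ∀ y, 0 ≤ G.ord f (G.vert y))
    (hconcave : ∀ e ∈ T, ConcavePLOn (fun u => f (G.pt e u)) 0 (G.len e)) {z : V}
    (hmin : ∀ x, f (G.vert z) ≤ f x) (y : V) : f (G.vert y) = f (G.vert z) := by
  have hmin' : ∀ {y}, f (G.vert y) = f (G.vert z) → ∀ x, f (G.vert y) ≤ f x :=
    fun hy x => hy.trans_le (hmin x)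
  refine Set.eq_univ_iff_forall.1
    (hG {y | f (G.vert y) = f (G.vert z)} ⟨z, rfl⟩ fun e he => ⟨fun hy => ?_, fun hy => ?_⟩) y
  · rw [Set.mem_ofPred_eq, ← hy, ← pt_len]
    exact hf.eq_right_of_minimal (hord _) (hmin' hy) (hconcave e he) ⟨(G.len_pos e).le, le_rfl⟩
  · rw [Set.mem_ofPred_eq, ← hy, ← pt_zero]
    exact hf.eq_left_of_minimal (hord _) (hmin' hy) (hconcave e he) ⟨le_rfl, (G.len_pos e).le⟩

theorem IsPL.eq_const_of_concavePLOn [Finite V] [Nonempty V] {T : Set E} (hG : G.ConnectedBy T)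
    (hf : G.IsPL f) (hord : ∀ y, 0 ≤ G.ord f (G.vert y))
    (hconcave : ∀ e ∈ T, ConcavePLOn (fun u => f (G.pt e u)) 0 (G.len e))
    (hbreak : ∀ e, ∃ t, ConcavePLOn (fun u => f (G.pt e u)) 0 t ∧
      ConcavePLOn (fun u => f (G.pt e u)) t (G.len e) ∧ ∃ z, f (G.vert z) ≤ f (G.pt e t)) :
    ∃ y, f = fun _ => y := by
  choose t hleft hright z' hz' using hbreak
  obtain ⟨z, hz⟩ := Finite.exists_min fun z => f (G.vert z)
  have hmin : ∀ x, f (G.vert z) ≤ f x := by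
    rintro (y | ⟨e, u, hu⟩)
    · exact hz y
    rw [← pt_of_mem e hu]
    have hbreak := (hz _).trans (hz' e)
    rcases le_total u (t e) with hut | htu
    · exact (le_min (by simpa only [pt_zero] using hz _) hbreak).trans
        ((hleft e).min_le hu.1.le hut)
    · exact (le_min hbreak (by simpa only [pt_len] using hz _)).trans
        ((hright e).min_le htu hu.2.le)
  have hvert := hf.eq_on_vertices_of_minimal hG hord hconcave hmin
  have hmin' : ∀ y x, f (G.vert y) ≤ f x := fun y x => (hvert y).trans_le (hmin x)
  refine ⟨f (G.vert z), funext ?_⟩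
  rintro (y | ⟨e, u, hu⟩)
  · exact hvert y
  rw [← pt_of_mem e hu]
  rcases le_total u (t e) with hut | htu
  · rw [hf.eq_right_of_minimal (hord _) (hmin' _) (hleft e) ⟨hu.1.le, hut⟩, hvert]
  · rw [hf.eq_left_of_minimal (hord _) (hmin' _) (hright e) ⟨htu, hu.2.le⟩, hvert]

theorem IsPL.eq_const_of_ord_nonneg [Finite V] [Nonempty V] (hG : G.ConnectedBy Set.univ)
    (hf : G.IsPL f) (hord : ∀ x, 0 ≤ G.ord f x) : ∃ y, f = fun _ => y := by
  have hconcave := fun e =>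
    hf.concavePLOn (e := e) le_rfl le_rfl fun u hu _ _ => hord (Sum.inr ⟨e, u, hu⟩)
  exact hf.eq_const_of_concavePLOn hG (fun y => hord _) (fun e _ => hconcave e) fun e =>
    ⟨0, (hconcave e).mono le_rfl (G.len_pos e).le, hconcave e, G.src e, by rw [pt_zero]⟩

theorem Moves.eq_add_const [Finite V] [Nonempty V] (hG : G.ConnectedBy Set.univ) {f' : G.Point → ℝ}
    {A B : G.Divisor} (h : G.Moves f A B) (h' : G.Moves f' A B) :
    ∃ y, ∀ x, f x = f' x + y := by
  have hdiff := h.add (h'.int_mul (-1))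
  obtain ⟨y, hy⟩ := hdiff.1.eq_const_of_ord_nonneg hG fun x => by
    have := hdiff.2 x
    simp only [Finsupp.add_apply, Finsupp.smul_apply] at this
    have := h.2 x
    have := h'.2 x
    simp only [neg_smul, one_smul] at *
    omega
  refine ⟨y, fun x => ?_⟩
  have := congrFun hy x
  push_cast at this
  linarith

end MaximumPrinciple

/-- A divisor is rigid if there is no other effective divisor in its class. -/
def IsRigid (A : G.Divisor) : Prop := ∀ A', 0 ≤ A' → G.LinEquiv A A' → A' = A

theorem Moves.eq_of_const {y : ℝ} {A B : G.Divisor} (h : G.Moves (fun _ => y) A B) : B = A := by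
  ext x
  rw [h.2, ord_const, add_zero]

theorem isRigid_zero [Finite V] [Nonempty V] (hG : G.ConnectedBy Set.univ) :
    IsRigid (0 : G.Divisor) := by
  rintro A' hA' ⟨f, hf⟩
  obtain ⟨y, rfl⟩ := hf.1.eq_const_of_ord_nonneg hG fun x => by
    simpa only [hf.2, Finsupp.zero_apply, zero_add] using hA' x
  exact hf.eq_of_const

section Interior

variable {f : G.Point → ℝ} {e : E} {t : ℝ}

theorem IsPL.min_le_interior (hf : G.IsPL f) (ht : t ∈ Set.Ioo 0 (G.len e))
    (hleft : ConcavePLOn (fun u => f (G.pt e u)) 0 t)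
    (hright : ConcavePLOn (fun u => f (G.pt e u)) t (G.len e))
    (hord : -1 ≤ G.ord f (Sum.inr ⟨e, t, ht⟩)) :
    min (f (G.vert (G.src e))) (f (G.vert (G.tgt e))) ≤ f (G.pt e t) := by
  by_contra! hlt
  obtain ⟨hsrc, htgt⟩ := lt_min_iff.1 hlt
  rw [← pt_zero e] at hsrc
  rw [← pt_len e] at htgt
  have hr := hright.rightSlope_pos ht.2 htgt ((hf.plOn e).right ht.1.le ht.2)
  have hl := hleft.leftSlope_pos ht.1 hsrc ((hf.plOn e).left ht.1 ht.2.le)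
  change -1 ≤ -(_ + _) at hord
  dsimp only at hord
  omega

theorem IsPL.eq_const_of_neg_one_le_ord [Finite V] [Nonempty V] (hG : G.ConnectedBy {e}ᶜ)
    (hf : G.IsPL f) (ht : t ∈ Set.Ioo 0 (G.len e)) (hord : ∀ x, x ≠ G.pt e t → 0 ≤ G.ord f x)
    (hordt : -1 ≤ G.ord f (Sum.inr ⟨e, t, ht⟩)) : ∃ y, f = fun _ => y := by
  have hord_vert : ∀ y, 0 ≤ G.ord f (G.vert y) := fun y => hord _ (by rw [pt_of_mem e ht]; simp)
  have hconcave : ∀ e' ≠ e, ConcavePLOn (fun u => f (G.pt e' u)) 0 (G.len e') := fun e' he' =>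
    hf.concavePLOn le_rfl le_rfl fun u hu _ _ => hord _ (by
      rw [pt_of_mem e ht]
      exact fun h => he' (Sigma.mk.inj (Sum.inr_injective h)).1)
  have hord_edge : ∀ u (hu : u ∈ Set.Ioo 0 (G.len e)), u ≠ t →
      0 ≤ G.ord f (Sum.inr ⟨e, u, hu⟩) := fun u hu hut =>
    hord _ (by rw [pt_of_mem e ht]; simpa using hut)
  have hleft := hf.concavePLOn le_rfl ht.2.le fun u hu _ hut => hord_edge u hu hut.ne
  have hright := hf.concavePLOn ht.1.le le_rfl fun u hu htu _ => hord_edge u hu htu.ne'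
  refine hf.eq_const_of_concavePLOn hG hord_vert hconcave fun e' => ?_
  by_cases he' : e' = e
  · subst he'
    exact ⟨t, hleft, hright,
      (min_le_iff.1 (hf.min_le_interior ht hleft hright hordt)).elim (⟨_, ·⟩) (⟨_, ·⟩)⟩
  · exact ⟨0, (hconcave e' he').mono le_rfl (G.len_pos e').le, hconcave e' he', G.src e',
      by rw [pt_zero]⟩

theorem isRigid_single_of_connectedBy_compl [Finite V] [Nonempty V] (hG : G.ConnectedBy {e}ᶜ)
    (ht : t ∈ Set.Ioo 0 (G.len e)) : IsRigid (Finsupp.single (G.pt e t) (1 : ℤ)) := by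
  rintro A' hA' ⟨f, hf⟩
  obtain ⟨y, rfl⟩ := hf.1.eq_const_of_neg_one_le_ord hG ht
    (fun x hx => by simpa [hf.2, Finsupp.single_apply, hx.symm] using hA' x)
    (by
      have hA't := hA' (G.pt e t)
      rw [hf.2, Finsupp.single_eq_same, pt_of_mem e ht, Finsupp.coe_zero, Pi.zero_apply] at hA't
      omega)
  exact hf.eq_of_const

end Interior

end MetricGraph

/-! ### Wedges -/

namespace MetricGraph

/-- An embedding of the metric graph `G` as a subgraph of `H`. -/
structure Sub {V E V' E' : Type} (G : MetricGraph V E) (H : MetricGraph V' E') where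
  onV : V → V'
  onE : E → E'
  onV_inj : Function.Injective onV
  onE_inj : Function.Injective onE
  src : ∀ e, H.src (onE e) = onV (G.src e)
  tgt : ∀ e, H.tgt (onE e) = onV (G.tgt e)
  len : ∀ e, H.len (onE e) = G.len e

namespace Sub

variable {V E V' E' : Type} {G : MetricGraph V E} {H : MetricGraph V' E'} (S : Sub G H)

/-- The embedding on points. -/
def map : G.Point → H.Point
  | Sum.inl x => Sum.inl (S.onV x)
  | Sum.inr p => Sum.inr ⟨S.onE p.1, ⟨p.2, by rw [S.len]; exact p.2.2⟩⟩

theorem map_inj : Function.Injective S.map := by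
  rintro (x | ⟨e, t, ht⟩) (y | ⟨e', t', ht'⟩) h
  · simp only [map, Sum.inl.injEq] at h
    rw [S.onV_inj h]
  · simp [map] at h
  · simp [map] at h
  · simp only [map, Sum.inr.injEq, Sigma.mk.injEq] at h
    obtain rfl := S.onE_inj h.1
    simpa using h.2

theorem map_pt (e : E) (t : ℝ) : S.map (G.pt e t) = H.pt (S.onE e) t := by
  by_cases h : t ∈ Set.Ioo 0 (G.len e)
  · have h' : t ∈ Set.Ioo 0 (H.len (S.onE e)) := by rwa [S.len]
    rw [pt_of_mem e h, pt_of_mem _ h']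
    rfl
  · have h' : t ∉ Set.Ioo 0 (H.len (S.onE e)) := by rwa [S.len]
    rw [pt, dif_neg h, pt, dif_neg h']
    split_ifs
    · rw [S.src]
      rfl
    · rw [S.tgt]
      rfl

theorem src_eq_iff (e : E) (x : V) : H.src (S.onE e) = S.onV x ↔ G.src e = x := by
  rw [S.src, S.onV_inj.eq_iff]

theorem tgt_eq_iff (e : E) (x : V) : H.tgt (S.onE e) = S.onV x ↔ G.tgt e = x := by
  rw [S.tgt, S.onV_inj.eq_iff]

/-- The image of a divisor on the subgraph. -/
noncomputable def push (A : G.Divisor) : H.Divisor := Finsupp.mapDomain S.map A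

theorem push_zero : S.push (0 : G.Divisor) = 0 := Finsupp.mapDomain_zero

theorem push_add (A B : G.Divisor) : S.push (A + B) = S.push A + S.push B :=
  Finsupp.mapDomain_add

theorem push_single (x : G.Point) (a : ℤ) :
    S.push (Finsupp.single x a) = Finsupp.single (S.map x) a := Finsupp.mapDomain_single

theorem push_map (A : G.Divisor) (x : G.Point) : S.push A (S.map x) = A x :=
  Finsupp.mapDomain_apply S.map_inj _ _

theorem degree_push (A : G.Divisor) : degree (S.push A) = degree A :=
  Finsupp.sum_mapDomain_index (fun _ => rfl) fun _ _ _ => rfl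

theorem push_nonneg {A : G.Divisor} (hA : 0 ≤ A) : 0 ≤ S.push A := fun z => by
  by_cases hz : z ∈ Set.range S.map
  · obtain ⟨x, rfl⟩ := hz
    exact (hA x).trans_eq (S.push_map A x).symm
  · exact (Finsupp.mapDomain_of_notMem_range _ _ hz).ge

theorem push_vert_eq_zero {A : G.Divisor} (hA : ∀ x, A (G.vert x) = 0) (z : V') :
    S.push A (H.vert z) = 0 := by
  by_cases hz : H.vert z ∈ Set.range S.map
  · obtain ⟨x | ⟨e, t⟩, hx⟩ := hz
    · rw [← hx, S.push_map, hA]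
    · cases hx
  · exact Finsupp.mapDomain_of_notMem_range _ _ hz

theorem isPL_comp {f : H.Point → ℝ} (hf : H.IsPL f) : G.IsPL (f ∘ S.map) := by
  intro e t
  have := hf (S.onE e) t
  rw [S.len] at this
  simpa only [Function.comp, S.map_pt] using this

end Sub

/-- The graph `H` is the union of the subgraphs `G₁` and `G₂` which have precisely one
vertex in common. -/
structure Wedge {V₁ E₁ V₂ E₂ V E : Type} [Fintype E₁] [Fintype E₂] [Fintype E]
    (G₁ : MetricGraph V₁ E₁) (G₂ : MetricGraph V₂ E₂) (H : MetricGraph V E)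
    (b₁ : V₁) (b₂ : V₂) where
  left : Sub G₁ H
  right : Sub G₂ H
  vert_eq_iff : ∀ x y, left.onV x = right.onV y ↔ x = b₁ ∧ y = b₂
  edge_ne : ∀ e e', left.onE e ≠ right.onE e'
  cover_vert : ∀ z, (∃ x, left.onV x = z) ∨ ∃ y, right.onV y = z
  cover_edge : ∀ z, (∃ x, left.onE x = z) ∨ ∃ y, right.onE y = z
  sum_eq : ∀ F : E → ℤ, ∑ e, F e = ∑ e, F (left.onE e) + ∑ e, F (right.onE e)

namespace Wedge

variable {V₁ E₁ V₂ E₂ V E : Type} [Fintype E₁] [Fintype E₂] [Fintype E]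
    {G₁ : MetricGraph V₁ E₁} {G₂ : MetricGraph V₂ E₂} {H : MetricGraph V E}
    {b₁ : V₁} {b₂ : V₂} (W : Wedge G₁ G₂ H b₁ b₂)

/-- The wedge with its two parts exchanged. -/
def symm : Wedge G₂ G₁ H b₂ b₁ where
  left := W.right
  right := W.left
  vert_eq_iff x y := by rw [eq_comm, W.vert_eq_iff, and_comm]
  edge_ne e e' := (W.edge_ne e' e).symm
  cover_vert z := (W.cover_vert z).symm
  cover_edge z := (W.cover_edge z).symm
  sum_eq F := by rw [W.sum_eq, add_comm]

theorem onV_base : W.left.onV b₁ = W.right.onV b₂ := (W.vert_eq_iff _ _).2 ⟨rfl, rfl⟩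

theorem map_base : W.left.map (G₁.vert b₁) = W.right.map (G₂.vert b₂) :=
  congrArg Sum.inl W.onV_base

theorem map_eq_iff (x : G₁.Point) (y : G₂.Point) :
    W.left.map x = W.right.map y ↔ x = G₁.vert b₁ ∧ y = G₂.vert b₂ := by
  rcases x with x | ⟨e, t⟩ <;> rcases y with y | ⟨e', t'⟩
  · simp [Sub.map, W.vert_eq_iff, vert]
  · simp [Sub.map, vert]
  · simp [Sub.map, vert]
  · simp [Sub.map, vert, W.edge_ne]

theorem cover (z : H.Point) : (∃ x, W.left.map x = z) ∨ ∃ y, W.right.map y = z := by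
  rcases z with z | ⟨e, t, ht⟩
  · rcases W.cover_vert z with ⟨x, rfl⟩ | ⟨y, rfl⟩
    · exact Or.inl ⟨G₁.vert x, rfl⟩
    · exact Or.inr ⟨G₂.vert y, rfl⟩
  · rcases W.cover_edge e with ⟨x, rfl⟩ | ⟨y, rfl⟩
    · exact Or.inl ⟨Sum.inr ⟨x, ⟨t, by rwa [← W.left.len]⟩⟩, rfl⟩
    · exact Or.inr ⟨Sum.inr ⟨y, ⟨t, by rwa [← W.right.len]⟩⟩, rfl⟩

theorem push_add_push_left (A : G₁.Divisor) (B : G₂.Divisor) {x : G₁.Point}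
    (hx : x ≠ G₁.vert b₁) : (W.left.push A + W.right.push B) (W.left.map x) = A x := by
  have hB : W.right.push B (W.left.map x) = 0 :=
    Finsupp.mapDomain_of_notMem_range _ _ fun ⟨y, hy⟩ => hx ((W.map_eq_iff x y).1 hy.symm).1
  rw [Finsupp.add_apply, Sub.push_map, hB, add_zero]

theorem push_add_push_right (A : G₁.Divisor) (B : G₂.Divisor) {y : G₂.Point}
    (hy : y ≠ G₂.vert b₂) : (W.left.push A + W.right.push B) (W.right.map y) = B y := by
  rw [add_comm]
  exact W.symm.push_add_push_left B A hy

theorem push_add_push_base (A : G₁.Divisor) (B : G₂.Divisor) :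
    (W.left.push A + W.right.push B) (W.left.map (G₁.vert b₁)) =
      A (G₁.vert b₁) + B (G₂.vert b₂) := by
  rw [Finsupp.add_apply, Sub.push_map, W.map_base, Sub.push_map]

theorem point_cases {P : H.Point → Prop} (hbase : P (W.left.map (G₁.vert b₁)))
    (hleft : ∀ x, x ≠ G₁.vert b₁ → P (W.left.map x))
    (hright : ∀ y, y ≠ G₂.vert b₂ → P (W.right.map y)) (z : H.Point) : P z := by
  rcases W.cover z with ⟨x, rfl⟩ | ⟨y, rfl⟩
  · by_cases hx : x = G₁.vert b₁
    exacts [hx ▸ hbase, hleft x hx]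
  · by_cases hy : y = G₂.vert b₂
    exacts [hy ▸ W.map_base ▸ hbase, hright y hy]

theorem exists_eq_push_add_push (F : H.Divisor) : ∃ (A : G₁.Divisor) (B : G₂.Divisor),
    F = W.left.push A + W.right.push B ∧ (0 ≤ F → 0 ≤ A ∧ 0 ≤ B) := by
  classical
  refine ⟨(F.comapDomain W.left.map W.left.map_inj.injOn).erase (G₁.vert b₁),
    F.comapDomain W.right.map W.right.map_inj.injOn, Finsupp.ext <| W.point_cases ?_ ?_ ?_,
    fun hF => ⟨fun x => ?_, fun y => hF _⟩⟩
  · rw [W.push_add_push_base, Finsupp.erase_same, zero_add, Finsupp.comapDomain_apply, W.map_base]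
  · intro x hx
    rw [W.push_add_push_left _ _ hx, Finsupp.erase_ne hx, Finsupp.comapDomain_apply]
  · intro y hy
    rw [W.push_add_push_right _ _ hy, Finsupp.comapDomain_apply]
  · rw [Finsupp.erase_apply]
    split_ifs
    exacts [le_rfl, hF _]

theorem isPL {f : H.Point → ℝ} (h₁ : G₁.IsPL (f ∘ W.left.map)) (h₂ : G₂.IsPL (f ∘ W.right.map)) :
    H.IsPL f := by
  intro e t
  rcases W.cover_edge e with ⟨e, rfl⟩ | ⟨e, rfl⟩
  · have := h₁ e t
    rw [W.left.len]
    simpa only [Function.comp, W.left.map_pt] using this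
  · have := h₂ e t
    rw [W.right.len]
    simpa only [Function.comp, W.right.map_pt] using this

theorem ord_left (f : H.Point → ℝ) {x : G₁.Point} (hx : x ≠ G₁.vert b₁) :
    H.ord f (W.left.map x) = G₁.ord (f ∘ W.left.map) x := by
  rcases x with x | ⟨e, t⟩
  · have hx : x ≠ b₁ := fun h => hx (by rw [h])
    have hne : ∀ y, W.right.onV y ≠ W.left.onV x := fun y hy =>
      hx ((W.vert_eq_iff _ _).1 hy.symm).1
    have hs : ∀ e, H.src (W.right.onE e) ≠ W.left.onV x := fun e => by rw [W.right.src]; exact hne _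
    have ht : ∀ e, H.tgt (W.right.onE e) ≠ W.left.onV x := fun e => by rw [W.right.tgt]; exact hne _
    change H.ord f (Sum.inl (W.left.onV x)) = _
    simp only [ord, W.sum_eq, hs, ht, W.left.len, if_false, Finset.sum_const_zero, add_zero,
      Function.comp_apply, W.left.map_pt]
    congr! 5
    exacts [W.left.src_eq_iff _ x, W.left.tgt_eq_iff _ x]
  · change -(_ + _) = _
    simp only [ord, Function.comp_apply, W.left.map_pt]

theorem ord_right (f : H.Point → ℝ) {y : G₂.Point} (hy : y ≠ G₂.vert b₂) :
    H.ord f (W.right.map y) = G₂.ord (f ∘ W.right.map) y := W.symm.ord_left f hy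

theorem ord_base (f : H.Point → ℝ) :
    H.ord f (W.left.map (G₁.vert b₁)) =
      G₁.ord (f ∘ W.left.map) (G₁.vert b₁) + G₂.ord (f ∘ W.right.map) (G₂.vert b₂) := by
  have hs : ∀ e, H.src (W.right.onE e) = W.left.onV b₁ ↔ G₂.src e = b₂ := fun e => by
    rw [W.onV_base, W.right.src_eq_iff]
  have ht : ∀ e, H.tgt (W.right.onE e) = W.left.onV b₁ ↔ G₂.tgt e = b₂ := fun e => by
    rw [W.onV_base, W.right.tgt_eq_iff]
  change H.ord f (Sum.inl (W.left.onV b₁)) = _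
  simp only [ord, W.sum_eq, W.left.len, W.right.len, Function.comp_apply, W.left.map_pt,
    W.right.map_pt]
  rw [← neg_add, add_add_add_comm]
  congr! 6
  exacts [W.left.src_eq_iff _ b₁, W.left.tgt_eq_iff _ b₁, hs _, ht _]

open Classical in
/-- The function on the wedge that is given by `f₁` and `f₂` on its two parts. -/
noncomputable def glue (f₁ : G₁.Point → ℝ) (f₂ : G₂.Point → ℝ) (z : H.Point) : ℝ :=
  if h : ∃ x, W.left.map x = z then f₁ h.choose
  else if h : ∃ y, W.right.map y = z then f₂ h.choose else 0

theorem glue_left (f₁ : G₁.Point → ℝ) (f₂ : G₂.Point → ℝ) :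
    W.glue f₁ f₂ ∘ W.left.map = f₁ := by
  funext x
  have hleft : ∃ x', W.left.map x' = W.left.map x := ⟨x, rfl⟩
  simp only [Function.comp, glue, dif_pos hleft]
  rw [W.left.map_inj hleft.choose_spec]

theorem glue_right {f₁ : G₁.Point → ℝ} {f₂ : G₂.Point → ℝ}
    (hb : f₁ (G₁.vert b₁) = f₂ (G₂.vert b₂)) : W.glue f₁ f₂ ∘ W.right.map = f₂ := by
  funext y
  by_cases h : ∃ x, W.left.map x = W.right.map y
  · have hbase := (W.map_eq_iff _ _).1 h.choose_spec
    simp only [Function.comp, glue, dif_pos h]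
    rw [hbase.1, hbase.2, hb]
  · have hright : ∃ y', W.right.map y' = W.right.map y := ⟨y, rfl⟩
    simp only [Function.comp, glue, dif_neg h, dif_pos hright]
    rw [W.right.map_inj hright.choose_spec]

section Moves

variable {A A' : G₁.Divisor} {B B' : G₂.Divisor}

theorem moves_glue {f₁ : G₁.Point → ℝ} {f₂ : G₂.Point → ℝ} (h₁ : G₁.Moves f₁ A A')
    (h₂ : G₂.Moves f₂ B B') (hb : f₁ (G₁.vert b₁) = f₂ (G₂.vert b₂)) :
    H.Moves (W.glue f₁ f₂) (W.left.push A + W.right.push B)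
      (W.left.push A' + W.right.push B') := by
  have hleft := W.glue_left f₁ f₂
  have hright := W.glue_right hb
  refine ⟨W.isPL (by rw [hleft]; exact h₁.1) (by rw [hright]; exact h₂.1),
    W.point_cases ?_ (fun x hx => ?_) fun y hy => ?_⟩
  · rw [W.push_add_push_base, W.push_add_push_base, W.ord_base, hleft, hright, h₁.2, h₂.2]
    ring
  · rw [W.push_add_push_left _ _ hx, W.push_add_push_left _ _ hx, W.ord_left _ hx, hleft, h₁.2]
  · rw [W.push_add_push_right _ _ hy, W.push_add_push_right _ _ hy, W.ord_right _ hy, hright, h₂.2]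

theorem exists_moves {f₁ : G₁.Point → ℝ} (h₁ : G₁.Moves f₁ A A') (h₂ : G₂.LinEquiv B B') :
    ∃ f, f ∘ W.left.map = f₁ ∧
      H.Moves f (W.left.push A + W.right.push B) (W.left.push A' + W.right.push B') := by
  obtain ⟨f₂, hf₂⟩ := h₂
  exact ⟨_, W.glue_left _ _, W.moves_glue h₁
    (hf₂.add_const (f₁ (G₁.vert b₁) - f₂ (G₂.vert b₂))) (by ring)⟩

theorem linEquiv_split {F : H.Divisor}
    (h : H.LinEquiv (W.left.push A + W.right.push B) F) :
    ∃ A' B', G₁.LinEquiv A A' ∧ G₂.LinEquiv B B' ∧ F = W.left.push A' + W.right.push B' := by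
  obtain ⟨f, hf⟩ := h
  obtain ⟨A₀, B₀, rfl, -⟩ := W.exists_eq_push_add_push F
  have hbase := hf.2 (W.left.map (G₁.vert b₁))
  rw [W.push_add_push_base, W.push_add_push_base, W.ord_base] at hbase
  -- the chips at the common vertex that have to be moved from `B₀` to `A₀`
  let s := A (G₁.vert b₁) + G₁.ord (f ∘ W.left.map) (G₁.vert b₁) - A₀ (G₁.vert b₁)
  refine ⟨A₀ + Finsupp.single (G₁.vert b₁) s, B₀ - Finsupp.single (G₂.vert b₂) s,
    ⟨_, W.left.isPL_comp hf.1, fun x => ?_⟩, ⟨_, W.right.isPL_comp hf.1, fun y => ?_⟩, ?_⟩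
  · by_cases hx : x = G₁.vert b₁
    · rw [hx, Finsupp.add_apply, Finsupp.single_eq_same]
      omega
    · rw [Finsupp.add_apply, Finsupp.single_eq_of_ne hx, add_zero, ← W.ord_left f hx,
        ← W.push_add_push_left A B hx, ← W.push_add_push_left A₀ B₀ hx, hf.2]
  · by_cases hy : y = G₂.vert b₂
    · rw [hy, Finsupp.sub_apply, Finsupp.single_eq_same]
      omega
    · rw [Finsupp.sub_apply, Finsupp.single_eq_of_ne hy, sub_zero, ← W.ord_right f hy,
        ← W.push_add_push_right A B hy, ← W.push_add_push_right A₀ B₀ hy, hf.2]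
  · rw [sub_eq_add_neg, ← Finsupp.single_neg, Sub.push_add, Sub.push_add, Sub.push_single,
      Sub.push_single, ← W.map_base, Finsupp.single_neg]
    abel

theorem isRigid_push_add_push (hA : IsRigid A) (hA₀ : A (G₁.vert b₁) = 0) (hB : IsRigid B)
    (hB₀ : B (G₂.vert b₂) = 0) : IsRigid (W.left.push A + W.right.push B) := by
  intro F hF h
  obtain ⟨A', B', hA', hB', rfl⟩ := W.linEquiv_split h
  have hleft : 0 ≤ A' (G₁.vert b₁) → A' = A := fun hbase => hA A' (fun x => by
    by_cases hx : x = G₁.vert b₁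
    exacts [hx ▸ hbase, (hF _).trans_eq (W.push_add_push_left A' B' hx)]) hA'
  have hright : 0 ≤ B' (G₂.vert b₂) → B' = B := fun hbase => hB B' (fun y => by
    by_cases hy : y = G₂.vert b₂
    exacts [hy ▸ hbase, (hF _).trans_eq (W.push_add_push_right A' B' hy)]) hB'
  have hsum : 0 ≤ A' (G₁.vert b₁) + B' (G₂.vert b₂) :=
    (hF _).trans_eq (W.push_add_push_base A' B')
  rcases le_or_gt 0 (A' (G₁.vert b₁)) with hbase | hbase
  · obtain rfl := hleft hbase
    rw [hright (by omega)]
  · obtain rfl := hright (by omega)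
    rw [hleft (by omega)]

end Moves

end Wedge

/-! ### Vertex avoiding series -/

/-- The divisor `D` behaves like a vertex avoiding divisor of rank `r` relative to the points `x`
and `y`, except that its sections `D + div (φ i) = R i + i x + c i y` have multiplicity `c i`
(possibly negative) at `y` rather than `r - i`. Uniqueness of the sections is expressed by rigidity
of the remainders `R i`. -/
structure IsSeries {V E : Type} [Fintype E] (G : MetricGraph V E) (x y : G.Point) {r : ℕ}
    (D : G.Divisor) (c : Fin (r + 1) → ℤ) (R : Fin (r + 1) → G.Divisor)
    (φ : Fin (r + 1) → G.Point → ℝ) : Prop where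
  moves (i : Fin (r + 1)) :
    G.Moves (φ i) D (R i + Finsupp.single x (i : ℤ) + Finsupp.single y (c i))
  nonneg (i : Fin (r + 1)) : 0 ≤ R i
  vert_eq_zero (i : Fin (r + 1)) (z : V) : R i (G.vert z) = 0
  rigid (i : Fin (r + 1)) : IsRigid (R i)
  rank (k : Fin (r + 1)) (F : G.Divisor) : 0 ≤ F → degree F = k →
    ∃ R', 0 ≤ R' ∧ G.LinEquiv D (F + R' + Finsupp.single y (c k))

/-- The data on `G` that continue a series with multiplicities `c` at `b` to one with
multiplicities `c'` at `t`: the chip `p` is added to the divisor and the remainders `Q i` to the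
remainders of the series. -/
structure IsContinuation {V E : Type} [Fintype E] (G : MetricGraph V E) (b t p : G.Point) {r : ℕ}
    (c c' : Fin (r + 1) → ℤ) (Q : Fin (r + 1) → G.Divisor) : Prop where
  linEquiv (i : Fin (r + 1)) : G.LinEquiv (Finsupp.single b (c i) + Finsupp.single p 1)
    (Q i + Finsupp.single t (c' i))
  nonneg (i : Fin (r + 1)) : 0 ≤ Q i
  vert_eq_zero (i : Fin (r + 1)) (z : V) : Q i (G.vert z) = 0
  rigid (i : Fin (r + 1)) : IsRigid (Q i)

theorem IsSeries.add_single {V E : Type} [Fintype E] {G : MetricGraph V E} {x y : G.Point} {r : ℕ}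
    {D : G.Divisor} {c : Fin (r + 1) → ℤ} {R : Fin (r + 1) → G.Divisor}
    {φ : Fin (r + 1) → G.Point → ℝ} (h : G.IsSeries x y D c R φ) (k : ℤ) :
    G.IsSeries x y (D + Finsupp.single y k) (fun i => c i + k) R φ where
  moves i := by
    simpa only [add_zero, Finsupp.single_add, add_assoc] using
      (h.moves i).add (moves_const 0 (Finsupp.single y k))
  nonneg := h.nonneg
  vert_eq_zero := h.vert_eq_zero
  rigid := h.rigid
  rank j F hF hdeg := by
    obtain ⟨R', hR', hequiv⟩ := h.rank j F hF hdeg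
    refine ⟨R', hR', ?_⟩
    simpa only [Finsupp.single_add, add_assoc] using hequiv.add_right (Finsupp.single y k)

theorem IsContinuation.exists_linEquiv {V E : Type} [Fintype E] {G : MetricGraph V E}
    {b t p : G.Point} {r : ℕ} {c c' : Fin (r + 1) → ℤ} {Q : Fin (r + 1) → G.Divisor}
    (hQ : G.IsContinuation b t p c c' Q)
    (heff : ∀ A : G.Divisor, 1 ≤ degree A → ∃ B, 0 ≤ B ∧ G.LinEquiv A B)
    (hgap : ∀ i j : Fin (r + 1), i < j → c' j + ((j : ℤ) - i) ≤ c i)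
    {j k : Fin (r + 1)} (hjk : j ≤ k) {B : G.Divisor} (hB : 0 ≤ B)
    (hdeg : degree B = (k : ℤ) - j) :
    ∃ R, 0 ≤ R ∧ G.LinEquiv (Finsupp.single b (c j) + Finsupp.single p 1)
      (B + R + Finsupp.single t (c' k)) := by
  rcases hjk.eq_or_lt with rfl | hlt
  · obtain rfl := eq_zero_of_degree_nonpos hB (by omega)
    exact ⟨Q j, hQ.nonneg j, by simpa only [zero_add] using hQ.linEquiv j⟩
  · obtain ⟨R, hR, hequiv⟩ := heff (Finsupp.single b (c j) + Finsupp.single p 1 -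
      (B + Finsupp.single t (c' k))) (by
        have := hgap j k hlt
        simp only [degree_sub, degree_add, degree_single, hdeg]
        omega)
    refine ⟨R, hR, ?_⟩
    have hadd := hequiv.add_right (B + Finsupp.single t (c' k))
    rwa [sub_add_cancel, add_comm R, add_right_comm] at hadd

namespace Wedge

variable {V₁ E₁ V₂ E₂ V E : Type} [Fintype E₁] [Fintype E₂] [Fintype E]
    {G₁ : MetricGraph V₁ E₁} {G₂ : MetricGraph V₂ E₂} {H : MetricGraph V E}
    {b₁ : V₁} {b₂ : V₂} (W : Wedge G₁ G₂ H b₁ b₂)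

theorem exists_moves_transfer {f₁ : G₁.Point → ℝ} {A A' : G₁.Divisor} {B B' : G₂.Divisor} {a : ℤ}
    (h₁ : G₁.Moves f₁ A (A' + Finsupp.single (G₁.vert b₁) a))
    (h₂ : G₂.LinEquiv (Finsupp.single (G₂.vert b₂) a + B) B') :
    ∃ f, f ∘ W.left.map = f₁ ∧
      H.Moves f (W.left.push A + W.right.push B) (W.left.push A' + W.right.push B') := by
  have hsource : W.left.push A + W.right.push B =
      W.left.push (A + Finsupp.single (G₁.vert b₁) (-a)) +
        W.right.push (Finsupp.single (G₂.vert b₂) a + B) := by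
    rw [Sub.push_add, Sub.push_add, Sub.push_single, Sub.push_single, ← W.map_base,
      Finsupp.single_neg]
    abel
  have hmoves := h₁.add (moves_const 0 (Finsupp.single (G₁.vert b₁) (-a)))
  rw [add_assoc, ← Finsupp.single_add, add_neg_cancel, Finsupp.single_zero, add_zero] at hmoves
  simp only [add_zero] at hmoves
  exact hsource ▸ W.exists_moves hmoves h₂

theorem exists_linEquiv_of_isSeries {x : G₁.Point} {t p : G₂.Point} {r : ℕ} {D : G₁.Divisor}
    {c c' : Fin (r + 1) → ℤ} {R : Fin (r + 1) → G₁.Divisor} {Q : Fin (r + 1) → G₂.Divisor}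
    {φ : Fin (r + 1) → G₁.Point → ℝ} (h : G₁.IsSeries x (G₁.vert b₁) D c R φ)
    (hQ : G₂.IsContinuation (G₂.vert b₂) t p c c' Q)
    (heff : ∀ A : G₂.Divisor, 1 ≤ degree A → ∃ B, 0 ≤ B ∧ G₂.LinEquiv A B)
    (hgap : ∀ i j : Fin (r + 1), i < j → c' j + ((j : ℤ) - i) ≤ c i)
    (k : Fin (r + 1)) {F : H.Divisor} (hF : 0 ≤ F) (hdeg : degree F = k) :
    ∃ R', 0 ≤ R' ∧ H.LinEquiv (W.left.push D + Finsupp.single (W.right.map p) 1)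
      (F + R' + Finsupp.single (W.right.map t) (c' k)) := by
  obtain ⟨A, B, rfl, hAB⟩ := W.exists_eq_push_add_push F
  obtain ⟨hA, hB⟩ := hAB hF
  rw [degree_add, Sub.degree_push, Sub.degree_push] at hdeg
  have hdegA := degree_nonneg hA
  have hdegB := degree_nonneg hB
  lift degree A to ℕ using hdegA with j hj
  have hjk : j ≤ k := by omega
  obtain ⟨R₁, hR₁, f, hf⟩ := h.rank ⟨j, by omega⟩ A hA hj.symm
  obtain ⟨R₂, hR₂, hequiv⟩ := hQ.exists_linEquiv heff hgap
    (Fin.mk_le_of_le_val hjk) hB (by simp only; omega)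
  obtain ⟨f', -, hmoves⟩ := W.exists_moves_transfer hf hequiv
  refine ⟨W.left.push R₁ + W.right.push R₂,
    add_nonneg (W.left.push_nonneg hR₁) (W.right.push_nonneg hR₂), f', ?_⟩
  simp only [Sub.push_add, Sub.push_single] at hmoves
  convert hmoves using 1
  abel

theorem exists_isSeries {x : G₁.Point} {t p : G₂.Point} {r : ℕ} {D : G₁.Divisor}
    {c c' : Fin (r + 1) → ℤ} {R : Fin (r + 1) → G₁.Divisor} {Q : Fin (r + 1) → G₂.Divisor}
    {φ : Fin (r + 1) → G₁.Point → ℝ} (h : G₁.IsSeries x (G₁.vert b₁) D c R φ)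
    (hQ : G₂.IsContinuation (G₂.vert b₂) t p c c' Q)
    (heff : ∀ A : G₂.Divisor, 1 ≤ degree A → ∃ B, 0 ≤ B ∧ G₂.LinEquiv A B)
    (hgap : ∀ i j : Fin (r + 1), i < j → c' j + ((j : ℤ) - i) ≤ c i) :
    ∃ R' φ', H.IsSeries (W.left.map x) (W.right.map t)
      (W.left.push D + Finsupp.single (W.right.map p) 1) c' R' φ' ∧
      ∀ i, φ' i ∘ W.left.map = φ i := by
  have hmoves : ∀ i, ∃ f, f ∘ W.left.map = φ i ∧
      H.Moves f (W.left.push D + Finsupp.single (W.right.map p) 1)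
        (W.left.push (R i) + W.right.push (Q i) + Finsupp.single (W.left.map x) (i : ℤ) +
          Finsupp.single (W.right.map t) (c' i)) := fun i => by
    obtain ⟨f, hf, hmoves⟩ := W.exists_moves_transfer (h.moves i) (hQ.linEquiv i)
    simp only [Sub.push_add, Sub.push_single] at hmoves
    exact ⟨f, hf, by convert hmoves using 1; abel⟩
  choose φ' hφ' hmoves using hmoves
  have hnonneg : ∀ i, 0 ≤ W.left.push (R i) + W.right.push (Q i) := fun i =>
    add_nonneg (W.left.push_nonneg (h.nonneg i)) (W.right.push_nonneg (hQ.nonneg i))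
  refine ⟨_, φ', ⟨hmoves, hnonneg, fun i z => ?_, fun i => W.isRigid_push_add_push (h.rigid i)
    (h.vert_eq_zero i b₁) (hQ.rigid i) (hQ.vert_eq_zero i b₂), fun k _ hF hdeg =>
      W.exists_linEquiv_of_isSeries h hQ heff hgap k hF hdeg⟩, hφ'⟩
  rw [Finsupp.add_apply, W.left.push_vert_eq_zero (h.vert_eq_zero i),
    W.right.push_vert_eq_zero (hQ.vert_eq_zero i), add_zero]

end Wedge

end MetricGraph

namespace ChainLengths

open MetricGraph

/-! ### The Picard group of a loop -/

/-- The `k`-th loop of the chain: the edges `0` (top) and `1` (bottom) join the vertices `0` (the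
left one, `v_k`) and `1` (the right one, `w_k`). -/
def loop (L : ChainLengths) (k : ℕ) : MetricGraph (Fin 2) (Fin 2) where
  src _ := 0
  tgt _ := 1
  len
    | 0 => L.top k
    | 1 => L.bottom k
  len_pos
    | 0 => L.top_pos k
    | 1 => L.bottom_pos k

/-- The circumference of the `k`-th loop. -/
noncomputable def girth (L : ChainLengths) (k : ℕ) : ℝ := L.bottom k + L.top k

theorem girth_pos (L : ChainLengths) (k : ℕ) : 0 < L.girth k :=
  add_pos (L.bottom_pos k) (L.top_pos k)

/-- The coordinate in `[0, girth)` of a point of a loop, which starts at the left vertex and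
traverses the bottom edge before the top edge. -/
noncomputable def coord (L : ChainLengths) (k : ℕ) : (L.loop k).Point → ℝ
  | Sum.inl 0 => 0
  | Sum.inl 1 => L.bottom k
  | Sum.inr ⟨0, t⟩ => L.girth k - t
  | Sum.inr ⟨1, t⟩ => t

variable {L : ChainLengths} {k : ℕ}

theorem ord_loop_left (f : (L.loop k).Point → ℝ) : (L.loop k).ord f ((L.loop k).vert 0) =
    -(rightSlope (fun u => f ((L.loop k).pt 0 u)) 0 +
      rightSlope (fun u => f ((L.loop k).pt 1 u)) 0) := by
  simp [ord, loop, Fin.sum_univ_two]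

theorem ord_loop_right (f : (L.loop k).Point → ℝ) : (L.loop k).ord f ((L.loop k).vert 1) =
    -(leftSlope (fun u => f ((L.loop k).pt 0 u)) (L.top k) +
      leftSlope (fun u => f ((L.loop k).pt 1 u)) (L.bottom k)) := by
  simp [ord, loop, Fin.sum_univ_two]

theorem coord_pt_bottom {u : ℝ} (hu : u ∈ Set.Icc 0 (L.bottom k)) :
    L.coord k ((L.loop k).pt 1 u) = u := by
  rcases hu.1.eq_or_lt with rfl | hu₀
  · rw [pt_zero]
    rfl
  · rcases hu.2.eq_or_lt with rfl | hu₁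
    · exact congrArg _ (pt_len (G := L.loop k) 1)
    · rw [pt_of_mem _ (show u ∈ Set.Ioo 0 ((L.loop k).len 1) from ⟨hu₀, hu₁⟩)]
      rfl

theorem coord_pt_top {u : ℝ} (hu : u ∈ Set.Ioc 0 (L.top k)) :
    L.coord k ((L.loop k).pt 0 u) = L.girth k - u := by
  rcases hu.2.eq_or_lt with rfl | hu₁
  · exact (congrArg _ (pt_len (G := L.loop k) 0)).trans (add_sub_cancel_right _ _).symm
  · rw [pt_of_mem _ (show u ∈ Set.Ioo 0 ((L.loop k).len 0) from ⟨hu.1, hu₁⟩)]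
    rfl

theorem loop_point_cases {P : (L.loop k).Point → Prop} (hleft : P ((L.loop k).vert 0))
    (hright : P ((L.loop k).vert 1))
    (htop : ∀ t (ht : t ∈ Set.Ioo 0 (L.top k)), P (Sum.inr ⟨0, t, ht⟩))
    (hbottom : ∀ t (ht : t ∈ Set.Ioo 0 (L.bottom k)), P (Sum.inr ⟨1, t, ht⟩)) (x) : P x :=
  match x with
  | Sum.inl 0 => hleft
  | Sum.inl 1 => hright
  | Sum.inr ⟨0, t, ht⟩ => htop t ht
  | Sum.inr ⟨1, t, ht⟩ => hbottom t ht

theorem coord_mem (x : (L.loop k).Point) : L.coord k x ∈ Set.Ico 0 (L.girth k) := by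
  have hgirth : L.girth k = L.bottom k + L.top k := rfl
  have htop := L.top_pos k
  have hbottom := L.bottom_pos k
  induction x using loop_point_cases with
  | hleft => exact ⟨le_rfl, L.girth_pos k⟩
  | hright => exact ⟨hbottom.le, by simp only [coord]; linarith⟩
  | htop t ht => constructor <;> simp only [coord] <;> linarith [ht.1, ht.2]
  | hbottom t ht => exact ⟨ht.1.le, by simp only [coord]; linarith [ht.2]⟩

theorem pt_coord (x : (L.loop k).Point) :
    (if L.coord k x ≤ L.bottom k then (L.loop k).pt 1 (L.coord k x)
      else (L.loop k).pt 0 (L.girth k - L.coord k x)) = x := by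
  have hgirth : L.girth k = L.bottom k + L.top k := rfl
  induction x using loop_point_cases with
  | hleft => exact (if_pos (L.bottom_pos k).le).trans (pt_zero 1)
  | hright => exact (if_pos le_rfl).trans (pt_len 1)
  | htop t ht =>
    have hlt : ¬ L.girth k - t ≤ L.bottom k := by linarith [ht.2]
    simp only [coord, if_neg hlt, sub_sub_cancel]
    exact pt_of_mem _ ht
  | hbottom t ht => exact (if_pos ht.2.le).trans (pt_of_mem (G := L.loop k) 1 ht)

theorem coord_injective : Function.Injective (L.coord k) := fun x y h => by
  rw [← pt_coord x, h, pt_coord]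

theorem exists_coord_eq {u : ℝ} (hu : u ∈ Set.Ico 0 (L.girth k)) : ∃ x, L.coord k x = u := by
  rcases le_or_gt u (L.bottom k) with hbottom | hbottom
  · exact ⟨_, coord_pt_bottom ⟨hu.1, hbottom⟩⟩
  · refine ⟨_, (coord_pt_top (u := L.girth k - u) ⟨sub_pos.2 hu.2, ?_⟩).trans (sub_sub_cancel _ _)⟩
    unfold girth
    linarith

section Slopes

variable {Φ : ℝ → ℝ} {u : ℝ} {a : ℤ}

theorem comp_coord_pt_top (hΦ : Φ 0 = Φ (L.girth k)) (hu : u ∈ Set.Icc 0 (L.top k)) :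
    Φ (L.coord k ((L.loop k).pt 0 u)) = Φ (L.girth k - u) := by
  rcases hu.1.eq_or_lt with rfl | hu₀
  · rw [pt_zero, sub_zero, ← hΦ]
    rfl
  · rw [coord_pt_top ⟨hu₀, hu.2⟩]

theorem hasRightSlope_comp_coord_bottom (h : HasRightSlope Φ u a)
    (hu : u ∈ Set.Ico 0 (L.bottom k)) :
    HasRightSlope (fun v => Φ (L.coord k ((L.loop k).pt 1 v))) u a :=
  h.congr hu.2 fun v huv hv => by rw [coord_pt_bottom ⟨hu.1.trans huv, hv.le⟩]

theorem hasLeftSlope_comp_coord_bottom (h : HasLeftSlope Φ u a)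
    (hu : u ∈ Set.Ioc 0 (L.bottom k)) :
    HasLeftSlope (fun v => Φ (L.coord k ((L.loop k).pt 1 v))) u a :=
  h.congr hu.1 fun v hv hvu => by rw [coord_pt_bottom ⟨hv.le, hvu.trans hu.2⟩]

theorem hasRightSlope_comp_coord_top (hΦ : Φ 0 = Φ (L.girth k))
    (h : HasLeftSlope Φ (L.girth k - u) a) (hu : u ∈ Set.Ico 0 (L.top k)) :
    HasRightSlope (fun v => Φ (L.coord k ((L.loop k).pt 0 v))) u a :=
  h.comp_const_sub.congr hu.2 fun _ huv hv => comp_coord_pt_top hΦ ⟨hu.1.trans huv, hv.le⟩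

theorem hasLeftSlope_comp_coord_top (hΦ : Φ 0 = Φ (L.girth k))
    (h : HasRightSlope Φ (L.girth k - u) a) (hu : u ∈ Set.Ioc 0 (L.top k)) :
    HasLeftSlope (fun v => Φ (L.coord k ((L.loop k).pt 0 v))) u a :=
  h.comp_const_sub.congr hu.1 fun _ hv hvu => comp_coord_pt_top hΦ ⟨hv.le, hvu.trans hu.2⟩

theorem isPL_comp_coord (hPL : PLOn Φ 0 (L.girth k)) (hΦ : Φ 0 = Φ (L.girth k)) :
    (L.loop k).IsPL (Φ ∘ L.coord k) := by
  have hgirth : L.girth k = L.bottom k + L.top k := rfl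
  have htop := L.top_pos k
  have hbottom := L.bottom_pos k
  refine Fin.forall_fin_two.2 ⟨fun t => ⟨fun ht₀ ht₁ => ?_, fun ht₀ ht₁ => ?_⟩,
    fun t => ⟨fun ht₀ ht₁ => ?_, fun ht₀ ht₁ => ?_⟩⟩
  · change t < L.top k at ht₁
    exact ⟨_, hasRightSlope_comp_coord_top hΦ (hPL.left (by linarith) (by linarith)) ⟨ht₀, ht₁⟩⟩
  · change t ≤ L.top k at ht₁
    exact ⟨_, hasLeftSlope_comp_coord_top hΦ (hPL.right (by linarith) (by linarith)) ⟨ht₀, ht₁⟩⟩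
  · change t < L.bottom k at ht₁
    exact ⟨_, hasRightSlope_comp_coord_bottom (hPL.right ht₀ (by linarith)) ⟨ht₀, ht₁⟩⟩
  · change t ≤ L.bottom k at ht₁
    exact ⟨_, hasLeftSlope_comp_coord_bottom (hPL.left ht₀ (by linarith)) ⟨ht₀, ht₁⟩⟩

theorem rightSlope_comp_coord_bottom (hPL : PLOn Φ 0 (L.girth k))
    (hu : u ∈ Set.Ico 0 (L.bottom k)) :
    rightSlope (fun v => Φ (L.coord k ((L.loop k).pt 1 v))) u = rightSlope Φ u :=
  have hgirth : L.bottom k ≤ L.girth k := le_add_of_nonneg_right (L.top_pos k).le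
  (hasRightSlope_comp_coord_bottom (hPL.right hu.1 (hu.2.trans_le hgirth)) hu).rightSlope_eq

theorem leftSlope_comp_coord_bottom (hPL : PLOn Φ 0 (L.girth k))
    (hu : u ∈ Set.Ioc 0 (L.bottom k)) :
    leftSlope (fun v => Φ (L.coord k ((L.loop k).pt 1 v))) u = leftSlope Φ u :=
  have hgirth : L.bottom k ≤ L.girth k := le_add_of_nonneg_right (L.top_pos k).le
  (hasLeftSlope_comp_coord_bottom (hPL.left hu.1 (hu.2.trans hgirth)) hu).leftSlope_eq

theorem rightSlope_comp_coord_top (hPL : PLOn Φ 0 (L.girth k)) (hΦ : Φ 0 = Φ (L.girth k))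
    (hu : u ∈ Set.Ico 0 (L.top k)) :
    rightSlope (fun v => Φ (L.coord k ((L.loop k).pt 0 v))) u = leftSlope Φ (L.girth k - u) :=
  have hgirth : L.top k ≤ L.girth k := le_add_of_nonneg_left (L.bottom_pos k).le
  (hasRightSlope_comp_coord_top hΦ
    (hPL.left (sub_pos.2 (hu.2.trans_le hgirth)) (sub_le_self _ hu.1)) hu).rightSlope_eq

theorem leftSlope_comp_coord_top (hPL : PLOn Φ 0 (L.girth k)) (hΦ : Φ 0 = Φ (L.girth k))
    (hu : u ∈ Set.Ioc 0 (L.top k)) :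
    leftSlope (fun v => Φ (L.coord k ((L.loop k).pt 0 v))) u = rightSlope Φ (L.girth k - u) :=
  have hgirth : L.top k ≤ L.girth k := le_add_of_nonneg_left (L.bottom_pos k).le
  (hasLeftSlope_comp_coord_top hΦ
    (hPL.right (sub_nonneg.2 (hu.2.trans hgirth)) (sub_lt_self _ hu.1)) hu).leftSlope_eq

theorem ord_comp_coord (hPL : PLOn Φ 0 (L.girth k)) (hΦ : Φ 0 = Φ (L.girth k))
    (x : (L.loop k).Point) :
    (L.loop k).ord (Φ ∘ L.coord k) x = -(rightSlope Φ (L.coord k x) +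
      leftSlope Φ (if L.coord k x = 0 then L.girth k else L.coord k x)) := by
  have hgirth : L.girth k = L.bottom k + L.top k := rfl
  have htop := L.top_pos k
  have hbottom := L.bottom_pos k
  induction x using loop_point_cases with
  | hleft =>
    simp only [ord_loop_left, Function.comp_apply]
    rw [rightSlope_comp_coord_top hPL hΦ ⟨le_rfl, htop⟩,
      rightSlope_comp_coord_bottom hPL ⟨le_rfl, hbottom⟩,
      show L.coord k ((L.loop k).vert 0) = 0 from rfl, if_pos rfl, sub_zero, add_comm]
  | hright =>
    simp only [ord_loop_right, Function.comp_apply]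
    rw [leftSlope_comp_coord_top hPL hΦ ⟨htop, le_rfl⟩,
      leftSlope_comp_coord_bottom hPL ⟨hbottom, le_rfl⟩,
      show L.coord k ((L.loop k).vert 1) = L.bottom k from rfl, if_neg hbottom.ne', girth,
      add_sub_cancel_right]
  | htop t ht =>
    rw [show L.coord k (Sum.inr ⟨0, t, ht⟩) = L.girth k - t from rfl,
      if_neg (by linarith [ht.2]), ← rightSlope_comp_coord_top hPL hΦ ⟨ht.1.le, ht.2⟩,
      ← leftSlope_comp_coord_top hPL hΦ ⟨ht.1, ht.2.le⟩, add_comm]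
    rfl
  | hbottom t ht =>
    rw [show L.coord k (Sum.inr ⟨1, t, ht⟩) = t from rfl, if_neg ht.1.ne',
      ← rightSlope_comp_coord_bottom hPL ⟨ht.1.le, ht.2⟩,
      ← leftSlope_comp_coord_bottom hPL ⟨ht.1, ht.2.le⟩]
    rfl

end Slopes

section Abel

variable (D : (L.loop k).Divisor)

/-- The moment of a divisor on a loop; modulo `girth` this is the Abel-Jacobi map. -/
noncomputable def moment : ℝ := D.sum fun x n => n * L.coord k x

theorem moment_add (A B : (L.loop k).Divisor) : moment (A + B) = moment A + moment B :=
  Finsupp.sum_add_index' (by simp) fun _ _ _ => by push_cast; ring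

theorem moment_sub (A B : (L.loop k).Divisor) : moment (A - B) = moment A - moment B :=
  Finsupp.sum_sub_index fun _ _ _ => by push_cast; ring

theorem moment_single (x : (L.loop k).Point) (n : ℤ) :
    moment (Finsupp.single x n) = n * L.coord k x :=
  Finsupp.sum_single_index (by simp)

theorem rampSum_coord_zero : rampSum D (L.coord k) 0 = 0 :=
  Finset.sum_eq_zero fun x _ => by
    dsimp only
    rw [max_eq_right (sub_nonpos.2 (coord_mem x).1), mul_zero]

theorem rampSum_coord_girth :
    rampSum D (L.coord k) (L.girth k) = degree D * L.girth k - moment D := by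
  simp only [rampSum, degree, moment, Finsupp.sum, Int.cast_sum, Finset.sum_mul,
    ← Finset.sum_sub_distrib]
  exact Finset.sum_congr rfl fun x _ => by
    rw [max_eq_left (sub_nonneg.2 (coord_mem x).2.le), mul_sub]

theorem linEquiv_zero_of_moment {j : ℤ} (hdeg : degree D = 0)
    (hmoment : moment D = j * L.girth k) : (L.loop k).LinEquiv D 0 := by
  set Φ : ℝ → ℝ := fun u => rampSum D (L.coord k) u + j * u
  have hright : ∀ u, HasRightSlope Φ u
      ((D.sum fun x n => if L.coord k x ≤ u then n else 0) + j * 1) :=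
    fun u => (hasRightSlope_rampSum D (L.coord k) u).add ((hasRightSlope_id u).int_mul j)
  have hleft : ∀ u, HasLeftSlope Φ u
      (-(D.sum fun x n => if L.coord k x < u then n else 0) + j * -1) :=
    fun u => (hasLeftSlope_rampSum D (L.coord k) u).add ((hasLeftSlope_id u).int_mul j)
  have hΦ : Φ 0 = Φ (L.girth k) := by
    simp only [Φ, rampSum_coord_zero, rampSum_coord_girth, hdeg, hmoment]
    push_cast
    ring
  have hPL : PLOn Φ 0 (L.girth k) := fun u => ⟨fun _ _ => ⟨_, hright u⟩, fun _ _ => ⟨_, hleft u⟩⟩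
  refine ⟨Φ ∘ L.coord k, isPL_comp_coord hPL hΦ, fun x => ?_⟩
  rw [ord_comp_coord hPL hΦ, (hright _).rightSlope_eq, (hleft _).leftSlope_eq,
    Finsupp.zero_apply, ← sum_le_sub_sum_lt D _ coord_injective x]
  split_ifs with hx
  · have hlt_zero : (D.sum fun y n => if L.coord k y < L.coord k x then n else 0) = 0 :=
      Finset.sum_eq_zero fun y _ => if_neg (hx ▸ (coord_mem y).1.not_gt)
    have hlt_girth : (D.sum fun y n => if L.coord k y < L.girth k then n else 0) = 0 := by
      rw [← hdeg]
      exact Finset.sum_congr rfl fun y _ => if_pos (coord_mem y).2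
    rw [hlt_zero, hlt_girth]
    ring
  · ring

theorem linEquiv_of_moment {A B : (L.loop k).Divisor} (j : ℤ) (hdeg : degree A = degree B)
    (hmoment : moment A = moment B + j * L.girth k) : (L.loop k).LinEquiv A B := by
  refine .of_sub (linEquiv_zero_of_moment (j := j) _ (by rw [degree_sub, hdeg, sub_self]) ?_)
  rw [moment_sub, hmoment, add_sub_cancel_left]

theorem exists_coord_congr (s : ℝ) : ∃ (x : (L.loop k).Point) (j : ℤ),
    s = L.coord k x + j * L.girth k := by
  obtain ⟨x, hx⟩ := exists_coord_eq (L := L) (toIcoMod_mem_Ico' (L.girth_pos k) s)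
  exact ⟨x, toIcoDiv (L.girth_pos k) 0 s, by
    rw [hx, ← zsmul_eq_mul, toIcoMod_add_toIcoDiv_zsmul]⟩

theorem exists_nonneg_linEquiv_of_one_le_degree (A : (L.loop k).Divisor) (hA : 1 ≤ degree A) :
    ∃ B, 0 ≤ B ∧ (L.loop k).LinEquiv A B := by
  obtain ⟨x, j, hx⟩ := exists_coord_congr (k := k) (moment A)
  refine ⟨Finsupp.single x 1 + Finsupp.single ((L.loop k).vert 0) (degree A - 1),
    add_nonneg (Finsupp.single_nonneg.2 zero_le_one) (Finsupp.single_nonneg.2 (by omega)),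
    linEquiv_of_moment j ?_ ?_⟩
  · rw [degree_add, degree_single, degree_single]
    ring
  · rw [moment_add, moment_single, moment_single, hx,
      show L.coord k ((L.loop k).vert 0) = 0 from rfl]
    ring

end Abel

/-! ### A loop with a bridge -/

/-- The `k`-th bridge as a metric graph: one edge from the vertex `0` to the vertex `1`. -/
def bridgeGraph (L : ChainLengths) (k : ℕ) : MetricGraph (Fin 2) Unit where
  src _ := 0
  tgt _ := 1
  len _ := L.bridge k
  len_pos _ := L.bridge_pos k

/-- The distance of a point of a bridge from the vertex `0`. -/
noncomputable def bridgeCoord (L : ChainLengths) (k : ℕ) : (L.bridgeGraph k).Point → ℝ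
  | Sum.inl 0 => 0
  | Sum.inl 1 => L.bridge k
  | Sum.inr ⟨_, t⟩ => t

/-- The graph consisting of the `k`-th loop and the bridge following it: the top edge `0` and the
bottom edge `1` join the vertices `0` (which is `v_k`) and `1` (which is `w_k`), and the bridge `2`
joins `1` to the vertex `2` (which is `v_{k+1}`). -/
def lollipop (L : ChainLengths) (k : ℕ) : MetricGraph (Fin 3) (Fin 3) where
  src
    | 0 => 0
    | 1 => 0
    | 2 => 1
  tgt
    | 0 => 1
    | 1 => 1
    | 2 => 2
  len
    | 0 => L.top k
    | 1 => L.bottom k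
    | 2 => L.bridge k
  len_pos
    | 0 => L.top_pos k
    | 1 => L.bottom_pos k
    | 2 => L.bridge_pos k

theorem bridgeCoord_mem (x : (L.bridgeGraph k).Point) :
    L.bridgeCoord k x ∈ Set.Icc 0 (L.bridge k) :=
  match x with
  | Sum.inl 0 => ⟨le_rfl, (L.bridge_pos k).le⟩
  | Sum.inl 1 => ⟨(L.bridge_pos k).le, le_rfl⟩
  | Sum.inr ⟨_, _, ht⟩ => ⟨ht.1.le, ht.2.le⟩

theorem bridgeCoord_pt {u : ℝ} (hu : u ∈ Set.Icc 0 (L.bridge k)) :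
    L.bridgeCoord k ((L.bridgeGraph k).pt () u) = u := by
  rcases hu.1.eq_or_lt with rfl | hu₀
  · rw [pt_zero]
    rfl
  · rcases hu.2.eq_or_lt with rfl | hu₁
    · exact congrArg _ (pt_len (G := L.bridgeGraph k) ())
    · rw [pt_of_mem _ (show u ∈ Set.Ioo 0 ((L.bridgeGraph k).len ()) from ⟨hu₀, hu₁⟩)]
      rfl

theorem pt_bridgeCoord (x : (L.bridgeGraph k).Point) :
    (L.bridgeGraph k).pt () (L.bridgeCoord k x) = x :=
  match x with
  | Sum.inl 0 => pt_zero ()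
  | Sum.inl 1 => pt_len (G := L.bridgeGraph k) ()
  | Sum.inr ⟨_, _, ht⟩ => pt_of_mem (G := L.bridgeGraph k) () ht

theorem bridgeCoord_injective : Function.Injective (L.bridgeCoord k) :=
  Function.LeftInverse.injective pt_bridgeCoord

theorem ord_bridgeGraph_left (f : (L.bridgeGraph k).Point → ℝ) :
    (L.bridgeGraph k).ord f ((L.bridgeGraph k).vert 0) =
      -rightSlope (fun u => f ((L.bridgeGraph k).pt () u)) 0 := by
  simp [ord, bridgeGraph]

theorem ord_bridgeGraph_right (f : (L.bridgeGraph k).Point → ℝ) :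
    (L.bridgeGraph k).ord f ((L.bridgeGraph k).vert 1) =
      -leftSlope (fun u => f ((L.bridgeGraph k).pt () u)) (L.bridge k) := by
  simp [ord, bridgeGraph]

theorem bridgeGraph_linEquiv_single_degree (A : (L.bridgeGraph k).Divisor) :
    (L.bridgeGraph k).LinEquiv A (Finsupp.single ((L.bridgeGraph k).vert 1) (degree A)) := by
  set f := rampSum A (L.bridgeCoord k) ∘ L.bridgeCoord k
  have hright : ∀ u ∈ Set.Ico 0 (L.bridge k),
      HasRightSlope (fun v => f ((L.bridgeGraph k).pt () v)) u
        (A.sum fun x n => if L.bridgeCoord k x ≤ u then n else 0) := fun u hu =>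
    (hasRightSlope_rampSum A (L.bridgeCoord k) u).congr hu.2 fun v huv hv => by
      simp only [f, Function.comp_apply, bridgeCoord_pt ⟨hu.1.trans huv, hv.le⟩]
  have hleft : ∀ u ∈ Set.Ioc 0 (L.bridge k),
      HasLeftSlope (fun v => f ((L.bridgeGraph k).pt () v)) u
        (-A.sum fun x n => if L.bridgeCoord k x < u then n else 0) := fun u hu =>
    (hasLeftSlope_rampSum A (L.bridgeCoord k) u).congr hu.1 fun v hv hvu => by
      simp only [f, Function.comp_apply, bridgeCoord_pt ⟨hv.le, hvu.trans hu.2⟩]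
  refine ⟨f, fun _ u => ⟨fun h₀ h₁ => ⟨_, hright u ⟨h₀, h₁⟩⟩, fun h₀ h₁ => ⟨_, hleft u ⟨h₀, h₁⟩⟩⟩,
    fun x => ?_⟩
  have hx := sum_le_sub_sum_lt A _ bridgeCoord_injective x
  match x with
  | Sum.inl 0 =>
    have hlt : (A.sum fun y n => if L.bridgeCoord k y < 0 then n else 0) = 0 :=
      Finset.sum_eq_zero fun y _ => if_neg (bridgeCoord_mem y).1.not_gt
    rw [show L.bridgeCoord k (Sum.inl 0) = 0 from rfl, hlt, sub_zero] at hx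
    rw [ord_bridgeGraph_left, (hright 0 ⟨le_rfl, L.bridge_pos k⟩).rightSlope_eq, ← hx,
      add_neg_cancel, Finsupp.single_eq_of_ne (by simp [vert])]
  | Sum.inl 1 =>
    have hle : (A.sum fun y n => if L.bridgeCoord k y ≤ L.bridge k then n else 0) = degree A :=
      Finset.sum_congr rfl fun y _ => if_pos (bridgeCoord_mem y).2
    rw [show L.bridgeCoord k (Sum.inl 1) = L.bridge k from rfl, hle] at hx
    rw [ord_bridgeGraph_right, (hleft _ ⟨L.bridge_pos k, le_rfl⟩).leftSlope_eq, ← hx,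
      Finsupp.single_eq_same]
    ring
  | Sum.inr ⟨(), t, ht⟩ =>
    rw [show L.bridgeCoord k (Sum.inr ⟨(), t, ht⟩) = t from rfl] at hx
    rw [ord, (hright t ⟨ht.1.le, ht.2⟩).rightSlope_eq, (hleft t ⟨ht.1, ht.2.le⟩).leftSlope_eq, ← hx,
      Finsupp.single_eq_of_ne (by simp [vert])]
    ring

/-- A lollipop is a loop with a bridge attached to its right vertex. -/
def lollipopWedge (L : ChainLengths) (k : ℕ) :
    Wedge (L.loop k) (L.bridgeGraph k) (L.lollipop k) 1 0 where
  left :=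
    { onV := Fin.castSucc
      onE := Fin.castSucc
      onV_inj := Fin.castSucc_injective 2
      onE_inj := Fin.castSucc_injective 2
      src := Fin.forall_fin_two.2 ⟨rfl, rfl⟩
      tgt := Fin.forall_fin_two.2 ⟨rfl, rfl⟩
      len := Fin.forall_fin_two.2 ⟨rfl, rfl⟩ }
  right :=
    { onV := Fin.succ
      onE := fun _ => 2
      onV_inj := Fin.succ_injective 2
      onE_inj := Function.injective_of_subsingleton _
      src := fun _ => rfl
      tgt := fun _ => rfl
      len := fun _ => rfl }
  vert_eq_iff := (by decide : ∀ x y : Fin 2, x.castSucc = y.succ ↔ x = 1 ∧ y = 0)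
  edge_ne := (by decide : ∀ e : Fin 2, ∀ _ : Unit, e.castSucc ≠ 2)
  cover_vert := (by decide : ∀ z : Fin 3, (∃ x : Fin 2, x.castSucc = z) ∨ ∃ y : Fin 2, y.succ = z)
  cover_edge := (by decide : ∀ e : Fin 3, (∃ x : Fin 2, x.castSucc = e) ∨ ∃ _ : Unit, 2 = e)
  sum_eq F := (Fin.sum_univ_castSucc F).trans (congrArg _ (Fintype.sum_unique fun _ => F 2).symm)

theorem lollipop_connectedBy_compl_top : (L.lollipop k).ConnectedBy {0}ᶜ := by
  intro S hS hclosed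
  have hbottom : 0 ∈ S ↔ 1 ∈ S := hclosed 1 (by decide)
  have hbridge : 1 ∈ S ↔ 2 ∈ S := hclosed 2 (by decide)
  obtain ⟨z, hz⟩ := hS
  refine Set.eq_univ_of_forall fun x => ?_
  fin_cases z <;> fin_cases x <;> simp_all

theorem exists_nonneg_linEquiv_lollipop (A : (L.lollipop k).Divisor) (hA : 1 ≤ degree A) :
    ∃ B, 0 ≤ B ∧ (L.lollipop k).LinEquiv A B := by
  let W := L.lollipopWedge k
  obtain ⟨A₁, A₂, rfl, -⟩ := W.exists_eq_push_add_push A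
  rw [degree_add, Sub.degree_push, Sub.degree_push] at hA
  obtain ⟨B, hB, hequiv⟩ := exists_nonneg_linEquiv_of_one_le_degree
    (A₁ + Finsupp.single ((L.loop k).vert 1) (degree A₂)) (by rwa [degree_add, degree_single])
  obtain ⟨f, hf⟩ : (L.loop k).LinEquiv A₁
      (B + Finsupp.single ((L.loop k).vert 1) (-degree A₂)) := by
    simpa only [Finsupp.single_neg, add_neg_cancel_right] using
      hequiv.add_right (-Finsupp.single ((L.loop k).vert 1) (degree A₂))
  have hbridge : (L.bridgeGraph k).LinEquiv
      (Finsupp.single ((L.bridgeGraph k).vert 0) (-degree A₂) + A₂) 0 := by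
    simpa only [degree_add, degree_single, neg_add_cancel, Finsupp.single_zero] using
      bridgeGraph_linEquiv_single_degree
        (Finsupp.single ((L.bridgeGraph k).vert 0) (-degree A₂) + A₂)
  obtain ⟨f', -, hf'⟩ := W.exists_moves_transfer hf hbridge
  exact ⟨_, add_nonneg (W.left.push_nonneg hB) (W.right.push_nonneg le_rfl), f', hf'⟩

/-! ### Continuing a series along a lollipop -/

theorem exists_top_coord {N K : ℤ} (hK : K * L.bottom k < L.top k) (hN : |N| ≤ K)
    (hN₀ : N ≠ 0) (hN₁ : N ≠ 1) :
    ∃ t ∈ Set.Ioo 0 (L.top k), ∃ j : ℤ, L.girth k - t = N * L.bottom k + j * L.girth k := by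
  have hbottom := L.bottom_pos k
  have hbound : |(N : ℝ)| * L.bottom k < L.top k :=
    (mul_le_mul_of_nonneg_right (by exact_mod_cast hN) hbottom.le).trans_lt hK
  rcases lt_or_gt_of_ne hN₀ with hneg | hpos
  · have hN' : (N : ℝ) ≤ -1 := by exact_mod_cast (by omega : N ≤ -1)
    rw [abs_of_neg (by linarith)] at hbound
    exact ⟨-N * L.bottom k, ⟨by nlinarith, hbound⟩, 1, by push_cast; ring⟩
  · have hN' : (2 : ℝ) ≤ N := by exact_mod_cast (by omega : 2 ≤ N)
    rw [abs_of_pos (by linarith)] at hbound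
    unfold girth
    exact ⟨L.bottom k + L.top k - N * L.bottom k, ⟨by linarith, by nlinarith⟩, 0,
      by push_cast; ring⟩

theorem lollipop_linEquiv {A Q : (L.loop k).Divisor} {n : ℤ}
    (h : (L.loop k).LinEquiv A (Q + Finsupp.single ((L.loop k).vert 1) n)) :
    (L.lollipop k).LinEquiv ((L.lollipopWedge k).left.push A)
      ((L.lollipopWedge k).left.push Q + Finsupp.single ((L.lollipop k).vert 2) n) := by
  obtain ⟨f, hf⟩ := h
  have hbridge := bridgeGraph_linEquiv_single_degree
    (Finsupp.single ((L.bridgeGraph k).vert 0) n + 0)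
  rw [add_zero, degree_single] at hbridge
  obtain ⟨f', -, hf'⟩ := (L.lollipopWedge k).exists_moves_transfer hf
    ((add_zero (Finsupp.single _ n)).symm ▸ hbridge)
  rw [Sub.push_single, Sub.push_zero, add_zero] at hf'
  exact ⟨f', hf'⟩

section Continuation

variable {N c j : ℤ} {x : (L.loop k).Point}

theorem loop_linEquiv_right (hx : N * L.bottom k = L.coord k x + j * L.girth k) (hN : N - c = 1) :
    (L.loop k).LinEquiv (Finsupp.single ((L.loop k).vert 0) c + Finsupp.single x 1)
      (Finsupp.single ((L.loop k).vert 1) N) := by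
  have hleft : L.coord k ((L.loop k).vert 0) = 0 := rfl
  have hright : L.coord k ((L.loop k).vert 1) = L.bottom k := rfl
  refine linEquiv_of_moment (-j) ?_ ?_
  · rw [degree_add, degree_single, degree_single, degree_single]
    omega
  · rw [moment_add, moment_single, moment_single, moment_single, hleft, hright, hx]
    push_cast
    ring

theorem loop_linEquiv_top_add_right (hx : N * L.bottom k = L.coord k x + j * L.girth k) {t : ℝ}
    (ht : t ∈ Set.Ioo 0 (L.top k)) {j' : ℤ}
    (hj' : L.girth k - t = (N - c : ℤ) * L.bottom k + j' * L.girth k) :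
    (L.loop k).LinEquiv (Finsupp.single ((L.loop k).vert 0) c + Finsupp.single x 1)
      (Finsupp.single ((L.loop k).pt 0 t) 1 + Finsupp.single ((L.loop k).vert 1) c) := by
  have hleft : L.coord k ((L.loop k).vert 0) = 0 := rfl
  have hright : L.coord k ((L.loop k).vert 1) = L.bottom k := rfl
  refine linEquiv_of_moment (-j - j') ?_ ?_
  · simp only [degree_add, degree_single, add_comm]
  · simp only [moment_add, moment_single, hleft, hright, coord_pt_top ⟨ht.1, ht.2.le⟩, hj']
    push_cast
    linarith

theorem exists_lollipop_section {K : ℤ} (hK : K * L.bottom k < L.top k) (hN : |N - c| ≤ K)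
    (hne : N ≠ c) (hx : N * L.bottom k = L.coord k x + j * L.girth k) :
    ∃ Q, (L.lollipop k).LinEquiv
        (Finsupp.single ((L.lollipop k).vert 0) c +
          Finsupp.single ((L.lollipopWedge k).left.map x) 1)
        (Q + Finsupp.single ((L.lollipop k).vert 2) (if N - c = 1 then N else c)) ∧
      0 ≤ Q ∧ (∀ z, Q ((L.lollipop k).vert z) = 0) ∧ IsRigid Q := by
  have hsource : Finsupp.single ((L.lollipop k).vert 0) c +
      Finsupp.single ((L.lollipopWedge k).left.map x) 1 = (L.lollipopWedge k).left.push
        (Finsupp.single ((L.loop k).vert 0) c + Finsupp.single x 1) := by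
    rw [Sub.push_add, Sub.push_single, Sub.push_single]
    rfl
  rw [hsource]
  split_ifs with hN₁
  · refine ⟨0, ?_, le_rfl, fun _ => rfl,
      isRigid_zero (lollipop_connectedBy_compl_top.mono (Set.subset_univ _))⟩
    have hequiv := loop_linEquiv_right hx hN₁
    rw [← zero_add (Finsupp.single ((L.loop k).vert 1) N)] at hequiv
    simpa only [Sub.push_zero] using lollipop_linEquiv hequiv
  · obtain ⟨t, ht, j', hj'⟩ := exists_top_coord hK hN (sub_ne_zero.2 hne) hN₁
    refine ⟨Finsupp.single ((L.lollipop k).pt 0 t) 1, ?_, Finsupp.single_nonneg.2 zero_le_one,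
      fun z => ?_, isRigid_single_of_connectedBy_compl lollipop_connectedBy_compl_top ht⟩
    · have hequiv := lollipop_linEquiv (loop_linEquiv_top_add_right hx ht hj')
      rwa [Sub.push_single _ (_ : (L.loop k).Point), Sub.map_pt] at hequiv
    · rw [pt_of_mem (G := L.lollipop k) 0 ht]
      exact Finsupp.single_eq_of_ne (by simp [vert])

end Continuation

theorem exists_isContinuation {r : ℕ} {c : Fin (r + 1) → ℤ} {N K : ℤ}
    (hK : K * L.bottom k < L.top k) (hN : ∀ i, |N - c i| ≤ K) (hne : ∀ i, N ≠ c i) :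
    ∃ p Q, (L.lollipop k).IsContinuation ((L.lollipop k).vert 0) ((L.lollipop k).vert 2) p c
      (fun i => if N - c i = 1 then N else c i) Q := by
  obtain ⟨x, j, hx⟩ := exists_coord_congr (k := k) (N * L.bottom k)
  choose Q hequiv hQ hvert hrigid using fun i => exists_lollipop_section hK (hN i) (hne i) hx
  exact ⟨_, Q, hequiv, hQ, hvert, hrigid⟩

end ChainLengths

/-! ### Series on chains of loops -/

namespace MetricGraph.IsSeries

variable {V E : Type} [Fintype E] {G : MetricGraph V E} {x y : G.Point} {r : ℕ} {D : G.Divisor}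
    {c : Fin (r + 1) → ℤ} {R : Fin (r + 1) → G.Divisor} {φ : Fin (r + 1) → G.Point → ℝ}

theorem rankGE (h : G.IsSeries x y D c R φ) (hc : 0 ≤ c (Fin.last r)) : G.RankGE D r := by
  intro F hF hdeg
  obtain ⟨R', hR', hequiv⟩ := h.rank (Fin.last r) F hF hdeg
  refine ⟨R' + Finsupp.single y (c (Fin.last r)),
    add_nonneg hR' (Finsupp.single_nonneg.2 hc), ?_⟩
  simpa only [add_assoc, add_sub_cancel_left] using hequiv.sub_right F

theorem not_rankGE_succ {v : V} (h : G.IsSeries x (G.vert v) D c R φ) (hc : c 0 ≤ r) :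
    ¬ G.RankGE D (r + 1) := by
  intro hrank
  obtain ⟨B, hB, hequiv⟩ := hrank (Finsupp.single (G.vert v) ((r : ℤ) + 1))
    (Finsupp.single_nonneg.2 (by omega)) (by rw [degree_single]; push_cast; rfl)
  set C := Finsupp.single (G.vert v) ((r : ℤ) + 1 - c 0) with hC
  have hC₀ : 0 ≤ C := Finsupp.single_nonneg.2 (by omega)
  have hrigid : B + C = R 0 := by
    refine h.rigid 0 _ (add_nonneg hB hC₀) (.trans (.symm ?_) (hequiv.add_right C))
    convert LinEquiv.add_right ⟨_, h.moves 0⟩ (-Finsupp.single (G.vert v) (c 0)) using 1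
    · rw [hC, Finsupp.single_sub]
      abel
    · simp
  have hvert := DFunLike.congr_fun hrigid (G.vert v)
  rw [Finsupp.add_apply, hC, Finsupp.single_eq_same, h.vert_eq_zero] at hvert
  have hBv : 0 ≤ B (G.vert v) := hB _
  omega

end MetricGraph.IsSeries

namespace ChainLengths

open MetricGraph

variable {L : ChainLengths} {g r m : ℕ}

theorem isSection_of_isSeries {D : (L.chain g).Divisor} {R : Fin (r + 1) → (L.chain g).Divisor}
    {φ : Fin (r + 1) → (L.chain g).Point → ℝ}
    (h : (L.chain g).IsSeries (L.leftEnd g) (L.rightEnd g) D (fun i => (r : ℤ) - i) R φ)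
    (i : Fin (r + 1)) : L.IsSection g r D i (R i + Finsupp.single (L.leftEnd g) (i : ℤ) +
      Finsupp.single (L.rightEnd g) ((r : ℤ) - i)) := by
  have hends : 0 ≤ Finsupp.single (L.leftEnd g) (i : ℤ) +
      Finsupp.single (L.rightEnd g) ((r : ℤ) - i) :=
    add_nonneg (Finsupp.single_nonneg.2 (by omega)) (Finsupp.single_nonneg.2 (by omega))
  refine ⟨⟨_, h.moves i⟩, ?_, ?_⟩ <;> rw [add_assoc]
  · exact le_add_of_nonneg_left (h.nonneg i)
  · exact add_nonneg (h.nonneg i) hends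

theorem vertexAvoiding_of_isSeries {D : (L.chain g).Divisor}
    {R : Fin (r + 1) → (L.chain g).Divisor} {φ : Fin (r + 1) → (L.chain g).Point → ℝ}
    (h : (L.chain g).IsSeries (L.leftEnd g) (L.rightEnd g) D (fun i => (r : ℤ) - i) R φ) :
    L.VertexAvoiding g r D := by
  refine fun i => ⟨_, isSection_of_isSeries h i, fun F hF => ?_, fun z => ?_⟩
  · have hrigid := h.rigid i _ (sub_nonneg.2 hF.2.1) (LinEquiv.of_sub ?_)
    · rw [add_assoc, ← hrigid, sub_add_cancel]
    · convert (LinEquiv.symm ⟨_, h.moves i⟩ |>.trans hF.1).sub_right F using 1 <;> abel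
  · rw [add_assoc, Finsupp.add_apply, h.vert_eq_zero, zero_add]

theorem VertexAvoiding.isSeries {D : (L.chain g).Divisor} (hv : L.VertexAvoiding g r D)
    (hrank : (L.chain g).RankGE D r) {F : Fin (r + 1) → (L.chain g).Divisor}
    (hF : ∀ i, L.IsSection g r D i (F i)) {φ : Fin (r + 1) → (L.chain g).Point → ℝ}
    (hφ : ∀ i, (L.chain g).Moves (φ i) D (F i)) :
    (L.chain g).IsSeries (L.leftEnd g) (L.rightEnd g) D (fun i => (r : ℤ) - i)
      (fun i => F i - (Finsupp.single (L.leftEnd g) (i : ℤ) +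
        Finsupp.single (L.rightEnd g) ((r : ℤ) - i))) φ where
  moves i := by simpa only [add_assoc, sub_add_cancel] using hφ i
  nonneg i := sub_nonneg.2 (hF i).2.1
  vert_eq_zero i z := by
    obtain ⟨F', -, hunique, hvert⟩ := hv i
    rw [hunique _ (hF i), Finsupp.sub_apply, hvert, sub_self]
  rigid i A hA hequiv := by
    obtain ⟨F', -, hunique, -⟩ := hv i
    set ends := Finsupp.single (L.leftEnd g) (i : ℤ) +
      Finsupp.single (L.rightEnd g) ((r : ℤ) - i)
    have hends : 0 ≤ ends :=
      add_nonneg (Finsupp.single_nonneg.2 (by omega)) (Finsupp.single_nonneg.2 (by omega))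
    have hequiv' := hequiv.add_right ends
    rw [sub_add_cancel] at hequiv'
    have hsection : L.IsSection g r D i (A + ends) :=
      ⟨(hF i).1.trans hequiv', le_add_of_nonneg_left hA, add_nonneg hA hends⟩
    rw [eq_sub_iff_add_eq, hunique _ hsection, hunique _ (hF i)]
  rank k A hA hdeg := by
    obtain ⟨B, hB, hequiv⟩ := hrank (A + Finsupp.single (L.rightEnd g) ((r : ℤ) - k))
      (add_nonneg hA (Finsupp.single_nonneg.2 (by omega)))
      (by rw [degree_add, degree_single, hdeg]; ring)
    refine ⟨B, hB, ?_⟩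
    have hadd := hequiv.add_right (A + Finsupp.single (L.rightEnd g) ((r : ℤ) - k))
    rwa [sub_add_cancel, ← add_assoc, add_comm B] at hadd

theorem chain_connectedBy_univ : (L.chain g).ConnectedBy Set.univ := by
  intro S hS h
  have hbridge (k : Fin (g + 1)) : Sum.inl k ∈ S ↔ Sum.inr k ∈ S :=
    h (Sum.inl k) (Set.mem_univ _)
  have hloop (k : Fin g) : Sum.inr k.castSucc ∈ S ↔ Sum.inl k.succ ∈ S :=
    h (Sum.inr (Sum.inl k)) (Set.mem_univ _)
  have hleft (k : Fin (g + 1)) : Sum.inl k ∈ S ↔ Sum.inl 0 ∈ S := by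
    induction k using Fin.induction with
    | zero => rfl
    | succ k ih => rw [← hloop, ← hbridge, ih]
  have hzero : Sum.inl 0 ∈ S := by
    obtain ⟨k | k, hk⟩ := hS
    · exact (hleft k).1 hk
    · exact (hleft k).1 ((hbridge k).2 hk)
  ext (k | k)
  · simp [hleft, hzero]
  · simp [← hbridge, hleft, hzero]

/-- The chain of `g` loops as a subgraph of the chain of `g + 1` loops. -/
def chainSub (L : ChainLengths) (g : ℕ) : Sub (L.chain g) (L.chain (g + 1)) where
  onV := Sum.map Fin.castSucc Fin.castSucc
  onE := Sum.map Fin.castSucc (Sum.map Fin.castSucc Fin.castSucc)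
  onV_inj := (Fin.castSucc_injective _).sumMap (Fin.castSucc_injective _)
  onE_inj := (Fin.castSucc_injective _).sumMap
    ((Fin.castSucc_injective _).sumMap (Fin.castSucc_injective _))
  src := by rintro (e | e | e) <;> rfl
  tgt := by rintro (e | e | e) <;> rfl
  len := by rintro (e | e | e) <;> rfl

/-- The last loop of the chain of `g + 1` loops, with the bridge to its right. -/
def lollipopSub (L : ChainLengths) (g : ℕ) : Sub (L.lollipop (g + 1)) (L.chain (g + 1)) where
  onV := fun
    | 0 => Sum.inr (Fin.last g).castSucc
    | 1 => Sum.inl (Fin.last (g + 1))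
    | 2 => Sum.inr (Fin.last (g + 1))
  onE := fun
    | 0 => Sum.inr (Sum.inl (Fin.last g))
    | 1 => Sum.inr (Sum.inr (Fin.last g))
    | 2 => Sum.inl (Fin.last (g + 1))
  onV_inj := by
    intro z z' h
    fin_cases z <;> fin_cases z' <;> simp_all [Fin.ext_iff]
  onE_inj := by
    intro e e' h
    fin_cases e <;> fin_cases e' <;> simp_all
  src := by intro e; match e with | 0 => rfl | 1 => rfl | 2 => rfl
  tgt := by intro e; match e with | 0 => rfl | 1 => rfl | 2 => rfl
  len := by intro e; match e with | 0 => rfl | 1 => rfl | 2 => rfl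

/-- The chain of `g + 1` loops as the chain of `g` loops with one more loop, and the bridge to its
right, attached at the right end. -/
def chainWedge (L : ChainLengths) (g : ℕ) :
    Wedge (L.chain g) (L.lollipop (g + 1)) (L.chain (g + 1)) (Sum.inr (Fin.last g)) 0 where
  left := L.chainSub g
  right := L.lollipopSub g
  vert_eq_iff := by
    rintro (x | x) y <;> fin_cases y <;> simp [chainSub, lollipopSub, Fin.ext_iff] <;> omega
  edge_ne := by
    rintro (e | e | e) e' <;> fin_cases e' <;> simp [chainSub, lollipopSub, Fin.ext_iff] <;> omega
  cover_vert := by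
    rintro (z | z) <;> induction z using Fin.lastCases with
      | last => first | exact Or.inr ⟨1, rfl⟩ | exact Or.inr ⟨2, rfl⟩
      | cast z => first | exact Or.inl ⟨Sum.inl z, rfl⟩ | exact Or.inl ⟨Sum.inr z, rfl⟩
  cover_edge := by
    rintro (z | z | z)
    · induction z using Fin.lastCases with
      | last => exact Or.inr ⟨2, rfl⟩
      | cast z => exact Or.inl ⟨Sum.inl z, rfl⟩
    · induction z using Fin.lastCases with
      | last => exact Or.inr ⟨0, rfl⟩
      | cast z => exact Or.inl ⟨Sum.inr (Sum.inl z), rfl⟩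
    · induction z using Fin.lastCases with
      | last => exact Or.inr ⟨1, rfl⟩
      | cast z => exact Or.inl ⟨Sum.inr (Sum.inr z), rfl⟩
  sum_eq F := by
    simp only [Fintype.sum_sum_type, Fin.sum_univ_three]
    rw [Fin.sum_univ_castSucc (n := g + 1), Fin.sum_univ_castSucc fun i => F (Sum.inr (Sum.inl i)),
      Fin.sum_univ_castSucc fun i => F (Sum.inr (Sum.inr i))]
    simp only [chainSub, lollipopSub, Sum.map_inl, Sum.map_inr]
    ring

end ChainLengths

theorem add_sub_le_of_strictAnti {n : ℕ} {c : Fin (n + 1) → ℤ} (hc : StrictAnti c)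
    {i j : Fin (n + 1)} (hij : i ≤ j) : c j + ((j : ℤ) - i) ≤ c i := by
  induction j using Fin.induction with
  | zero => obtain rfl := Fin.le_zero_iff.1 hij; simp
  | succ j ih =>
    rcases hij.eq_or_lt with rfl | hlt
    · simp
    · have hstep := hc j.castSucc_lt_succ
      have hle := ih (Fin.le_castSucc_iff.2 hlt)
      simp only [Fin.val_castSucc, Fin.val_succ] at hle ⊢
      push_cast
      omega

theorem raised_add_sub_le_of_strictAnti {n : ℕ} {c : Fin (n + 1) → ℤ} (hc : StrictAnti c) {N : ℤ}
    (hne : ∀ i, N ≠ c i) {i j : Fin (n + 1)} (hij : i < j) :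
    (if N - c j = 1 then N else c j) + ((j : ℤ) - i) ≤ c i := by
  obtain ⟨j, rfl⟩ := Fin.exists_succ_eq.2 (Fin.ne_zero_of_lt hij)
  have hstep := hc j.castSucc_lt_succ
  have hle := add_sub_le_of_strictAnti hc (Fin.le_castSucc_iff.2 hij)
  have hraised : (if N - c j.succ = 1 then N else c j.succ) < c j.castSucc := by
    have := hne j.castSucc
    split_ifs <;> omega
  simp only [Fin.val_castSucc, Fin.val_succ] at hle ⊢
  push_cast
  omega

namespace ChainLengths

open MetricGraph

variable {L : ChainLengths} {g r m : ℕ} {c : Fin (r + 1) → ℤ} {d : ℤ}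

/-- The chain of `g` loops carries a series with multiplicities `c` at the right end, on a divisor
of degree `d`, such that the sums of `m` of its functions are tropically independent. -/
def HasIndependentSeries (L : ChainLengths) (g r m : ℕ) (c : Fin (r + 1) → ℤ) (d : ℤ) : Prop :=
  ∃ D R φ, degree D = d ∧ (L.chain g).IsSeries (L.leftEnd g) (L.rightEnd g) D c R φ ∧
    TropicallyIndependent
      (fun (I : Sym (Fin (r + 1)) m) x => ((I : Multiset (Fin (r + 1))).map fun i => φ i x).sum)
      Finset.univ

theorem HasIndependentSeries.add_const (h : L.HasIndependentSeries g r m c d) (k : ℤ) :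
    L.HasIndependentSeries g r m (fun i => c i + k) (d + k) := by
  obtain ⟨D, R, φ, hd, hseries, hind⟩ := h
  exact ⟨_, R, φ, by rw [degree_add, degree_single, hd], hseries.add_single k, hind⟩

theorem HasIndependentSeries.succ (h : L.HasIndependentSeries g r m c d) (hc : StrictAnti c)
    {K N : ℤ} (hK : K * L.bottom (g + 1) < L.top (g + 1)) (hN : ∀ i, |N - c i| ≤ K)
    (hne : ∀ i, N ≠ c i) :
    L.HasIndependentSeries (g + 1) r m (fun i => if N - c i = 1 then N else c i) (d + 1) := by
  obtain ⟨D, R, φ, hd, hseries, hind⟩ := h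
  obtain ⟨p, Q, hQ⟩ := exists_isContinuation hK hN hne
  obtain ⟨R', φ', hseries', hφ'⟩ := (L.chainWedge g).exists_isSeries hseries hQ
    exists_nonneg_linEquiv_lollipop fun i j => raised_add_sub_le_of_strictAnti hc hne
  refine ⟨_, R', φ', ?_, hseries', fun ⟨a, ha⟩ => hind ⟨a, fun x => ?_⟩⟩
  · rw [degree_add, Sub.degree_push, degree_single, hd]
  · simpa only [← hφ', Function.comp_apply] using ha ((L.chainWedge g).left.map x)

theorem HasIndependentSeries.succ_const
    (h : L.HasIndependentSeries g r m (fun i => (r : ℤ) - i) d)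
    (hK : ((r : ℝ) + 2) * L.bottom (g + 1) < L.top (g + 1)) :
    L.HasIndependentSeries (g + 1) r m (fun i => (r : ℤ) - i) (d + 1) := by
  convert h.succ (K := r + 2) (N := -1) (fun i j hij => by simp only; omega)
    (by push_cast; exact hK) (fun i => by rw [abs_le]; omega) (fun i => by omega) using 2 with i
  rw [if_neg (by omega)]

theorem HasIndependentSeries.add_loops
    (h : L.HasIndependentSeries g r m (fun i => (r : ℤ) - i) d) (j : ℕ) (hj : j ≤ r + 1)
    (hK : ∀ k ∈ Finset.Ioc g (g + j), ((r : ℝ) + 2) * L.bottom k < L.top k) :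
    L.HasIndependentSeries (g + j) r m
      (fun i => if (i : ℕ) < j then (r : ℤ) - i else (r : ℤ) - 1 - i) (d - 1 + j) := by
  induction j with
  | zero =>
    convert h.add_const (-1) using 1
    · rfl
    · funext i
      rw [if_neg (Nat.not_lt_zero _)]
      ring
    · push_cast
      ring
  | succ j ih =>
    have hprev := ih (by omega) fun k hk => hK k (Finset.Ioc_subset_Ioc_right (by omega) hk)
    convert hprev.succ (K := r + 2) (N := (r : ℤ) - j)
      (fun i k (hik : (i : ℕ) < k) => by dsimp only; split_ifs <;> omega)
      (by push_cast; exact hK (g + j + 1) (Finset.mem_Ioc.2 ⟨by omega, by omega⟩))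
      (fun i => by rw [abs_le]; split_ifs <;> omega)
      (fun i => by split_ifs <;> omega) using 1
    · rfl
    · funext i
      split_ifs <;> omega
    · push_cast
      ring

theorem Admissible.mono {g' b : ℕ} {C : ℝ} (h : L.Admissible g' r b C) (hg : g ≤ g') :
    L.Admissible g r b C := by
  have hsub : Finset.Icc 1 g ⊆ Finset.Icc 1 g' := Finset.Icc_subset_Icc_right hg
  obtain ⟨hloop, hbridge, hgeneric, hblock⟩ := h
  refine ⟨fun k hk => lt_of_le_of_lt ?_ (hloop k (hsub hk)), fun k hk => hbridge k (hsub hk),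
    fun c hc hsum k hk => ?_, fun α hα hle => hblock α hα (hle.trans hg)⟩
  · have := (L.bottom_pos k).le
    gcongr
  · have hzero := hgeneric (fun k => if k ∈ Finset.Icc 1 g then c k else 0) (fun k _ => ?_) ?_ k
      (hsub hk)
    · simpa only [if_pos hk] using hzero
    · split_ifs with hk
      · exact (hc k hk).trans (by omega)
      · rw [abs_zero]
        positivity
    · rw [← Finset.sum_subset hsub, ← hsum]
      · exact Finset.sum_congr rfl fun k hk => by rw [if_pos hk]
      · intro k _ hk
        rw [if_neg hk, Int.cast_zero, zero_mul]

theorem Admissible.mul_bottom_lt {b : ℕ} {C : ℝ} (h : L.Admissible g r b C) {n k : ℕ} (hn : n ≤ g)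
    (hk : k ∈ Finset.Icc 1 g) : n * L.bottom k < L.top k := by
  refine lt_of_le_of_lt ?_ (h.1 k hk)
  have hn' : (n : ℝ) ≤ 4 * g := by
    exact_mod_cast hn.trans (Nat.le_mul_of_pos_left g (by norm_num))
  exact mul_le_mul_of_nonneg_right hn' (L.bottom_pos k).le

end ChainLengths

/-! ### The injective range -/

theorem card_sym_fin (r m : ℕ) : Fintype.card (Sym (Fin (r + 1)) m) = (r + m).choose m := by
  rw [Sym.card_sym_fin_eq_multichoose, Nat.multichoose_eq]
  congr 1
  omega

theorem MaximalRankOn.hasIndependentSeries {L : ChainLengths} {r s ρ m : ℕ}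
    (hinj : InjectiveRange r s ρ m) (h : MaximalRankOn L r s ρ m) :
    L.HasIndependentSeries (genus r s ρ) r m (fun i => (r : ℤ) - i) (curveDegree r s ρ) := by
  obtain ⟨D, hrank, hd, hv, F, hF, ψ, hψ, A, hA, hind⟩ := h
  choose φ hφ using fun i => (hF i).1
  refine ⟨D, _, φ, hd, hv.isSeries hrank.1 hF hφ, ?_⟩
  obtain rfl : A = Finset.univ := by
    rw [← Finset.card_eq_iff_eq_univ, card_sym_fin]
    rw [min_eq_left hinj] at hA
    exact_mod_cast hA
  have hconst (I : Sym (Fin (r + 1)) m) : ∃ a : ℝ, ∀ x,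
      ((I : Multiset (Fin (r + 1))).map fun i => φ i x).sum = ψ I x + a := by
    have hsum := MetricGraph.moves_multiset_sum hφ (I : Multiset (Fin (r + 1)))
    rw [Sym.card_coe] at hsum
    exact hsum.eq_add_const ChainLengths.chain_connectedBy_univ (hψ I)
  choose a ha using hconst
  rintro ⟨c, hc⟩
  refine hind ⟨fun I => a I + c I, fun x => ?_⟩
  simpa only [ha, add_assoc] using hc x

theorem maximalRankOn_of_hasIndependentSeries {L : ChainLengths} {r s ρ m : ℕ}
    (hinj : InjectiveRange r s ρ m)
    (h : L.HasIndependentSeries (genus r s ρ) r m (fun i => (r : ℤ) - i) (curveDegree r s ρ)) :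
    MaximalRankOn L r s ρ m := by
  obtain ⟨D, R, φ, hd, hseries, hind⟩ := h
  refine ⟨D, ⟨hseries.rankGE (by simp), hseries.not_rankGE_succ (by simp)⟩, hd,
    ChainLengths.vertexAvoiding_of_isSeries hseries, _, ChainLengths.isSection_of_isSeries hseries,
    _, fun I => ?_, Finset.univ, ?_, hind⟩
  · simpa only [Sym.card_coe] using
      MetricGraph.moves_multiset_sum hseries.moves (I : Multiset (Fin (r + 1)))
  · rw [Finset.card_univ, card_sym_fin, min_eq_left hinj]

theorem succ_le_genus {r s ρ : ℕ} (hs : 1 ≤ s) : r + 1 ≤ genus r s ρ :=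
  (Nat.le_mul_of_pos_right _ hs).trans (Nat.le_add_right _ _)

theorem InjectiveRange.two_le {r s ρ m : ℕ} (hs : 1 ≤ s) (h : InjectiveRange r s ρ m) :
    2 ≤ m := by
  have hgenus : r + 1 ≤ genus r s ρ := succ_le_genus hs
  by_contra! hlt
  interval_cases m <;>
  · simp only [InjectiveRange, expectedDim, curveDegree, Nat.choose_zero_right,
      Nat.choose_one_right, Nat.cast_zero, Nat.cast_one, Nat.cast_add] at h
    omega

theorem InjectiveRange.rho_succ {r s ρ m : ℕ} (hm : 1 ≤ m) (h : InjectiveRange r s ρ m) :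
    InjectiveRange r s (ρ + 1) m := by
  refine le_trans h ?_
  simp only [expectedDim, curveDegree, genus]
  push_cast
  nlinarith

theorem InjectiveRange.s_succ {r s ρ m : ℕ} (hr : 1 ≤ r) (hm : 2 ≤ m)
    (h : InjectiveRange r s ρ m) : InjectiveRange r (s + 1) ρ m := by
  refine le_trans h ?_
  simp only [expectedDim, curveDegree, genus]
  push_cast
  nlinarith

theorem MaximalRankOn.rho_succ {L : ChainLengths} {r s ρ m : ℕ} (hinj : InjectiveRange r s ρ m)
    (hm : 1 ≤ m) (h : MaximalRankOn L r s ρ m)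
    (hK : ((r : ℝ) + 2) * L.bottom (genus r s ρ + 1) < L.top (genus r s ρ + 1)) :
    MaximalRankOn L r s (ρ + 1) m := by
  refine maximalRankOn_of_hasIndependentSeries (hinj.rho_succ hm) ?_
  have hgenus : genus r s (ρ + 1) = genus r s ρ + 1 := rfl
  rw [hgenus]
  convert (h.hasIndependentSeries hinj).succ_const hK using 1
  rw [curveDegree, curveDegree, hgenus]
  push_cast
  ring

theorem MaximalRankOn.s_succ {L : ChainLengths} {r s ρ m : ℕ} (hinj : InjectiveRange r s ρ m)
    (hr : 1 ≤ r) (hm : 2 ≤ m) (h : MaximalRankOn L r s ρ m)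
    (hK : ∀ k ∈ Finset.Ioc (genus r s ρ) (genus r (s + 1) ρ),
      ((r : ℝ) + 2) * L.bottom k < L.top k) :
    MaximalRankOn L r (s + 1) ρ m := by
  have hgenus : genus r (s + 1) ρ = genus r s ρ + (r + 1) := by
    rw [genus, genus]
    ring
  refine maximalRankOn_of_hasIndependentSeries (hinj.s_succ hr hm) ?_
  rw [hgenus] at hK ⊢
  convert (h.hasIndependentSeries hinj).add_loops (r + 1) le_rfl hK using 1
  · funext i
    rw [if_pos i.2]
  · rw [curveDegree, curveDegree, hgenus]
    push_cast
    ring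

theorem theorem1p1_general (r s ρ m b : ℕ) (hr : 1 ≤ r) (hs : 1 ≤ s)
    (hinj : InjectiveRange r s ρ m) (h : TropicalMaximalRank b r s ρ m) :
    TropicalMaximalRank b r s (ρ + 1) m ∧ TropicalMaximalRank b r (s + 1) ρ m := by
  obtain ⟨C, hC, hmax⟩ := h
  have hm := hinj.two_le hs
  have hgenus : r + 1 ≤ genus r s ρ := succ_le_genus hs
  refine ⟨⟨C, hC, fun L hL => ?_⟩, ⟨C, hC, fun L hL => ?_⟩⟩
  · have hg : genus r s (ρ + 1) = genus r s ρ + 1 := rfl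
    refine (hmax L (hL.mono (by omega))).rho_succ hinj (by omega) ?_
    exact_mod_cast hL.mul_bottom_lt (n := r + 2) (by omega) (Finset.mem_Icc.2 (by omega))
  · have hg : genus r s ρ + 1 ≤ genus r (s + 1) ρ := by rw [genus, genus, mul_add]; omega
    refine (hmax L (hL.mono (by omega))).s_succ hinj hr hm fun k hk => ?_
    have hk := Finset.mem_Ioc.1 hk
    exact_mod_cast hL.mul_bottom_lt (n := r + 2) (by omega) (Finset.mem_Icc.2 (by omega))

theorem theorem1p1 (r s ρ m b : ℕ) (hr : 3 ≤ r) (hs : 1 ≤ s) (hm : 1 ≤ m) (hb : 1 ≤ b)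
    (hinj : InjectiveRange r s ρ m) :
    TropicalMaximalRank b r s ρ m →
      TropicalMaximalRank b r s (ρ + 1) m ∧ TropicalMaximalRank b r (s + 1) ρ m :=
  theorem1p1_general r s ρ m b (by omega) hs hinj
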